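/- Setting. Let $V$ be a ground set, let $f$ be a monotone submodular function on the finite subsets of $V$ with $f(\emptyset)=0$, and let $\mathcal M$ be a matroid of rank $k$ on $V$. A stream is a sequence, fixed in advance (oblivious adversary), of $n$ insertions and $n$ deletions of elements of $V$ in any order, in which only absent elements are inserted and only present elements are deleted. $V_i$ is the set of elements present after the first $i$ operations, and $\mathrm{OPT}_i=\max\{f(T): T\subseteq V_i,\ T\in\mathcal M\}$. A fully dynamic algorithm is randomized, processes the operations one by one as they arrive (without knowing $n$), accesses $f$ and $\mathcal M$ only through a value oracle, which returns $f(S)$, and an independence oracle, which tells whether $S\in\mathcal M$, and maintains a solution $S^i$ after each operation $i$. It is an $\alpha$-approximation if, on every stream and for every outcome of its random choices, $S^i\subseteq V_i$, $S^i\in\mathcal M$ and $\mathrm{OPT}_i\le\alpha f(S^i)$ for all $i\le 2n$. Its running time is the number of oracle calls; it has expected amortized running time $t(n)$ if for every $n$ and every stream of $n$ insertions and $n$ deletions the expected total number of oracle calls is at most $2n\,t(n)$. Corollary. For any constant $\varepsilon>0$ there is a $(4+O(\varepsilon))$-approximation to fully dynamic monotone submodular maximization under a matroid constraint with expected amortized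 running time $$O\!\left(\frac{k^2}{\varepsilon}\,\log k\,\log^2 n\,\log^3\frac{k}{\varepsilon}\right),$$ where $\log x$ is read as $\log(x+1)$, so that the bound does not degenerate when $k=1$, $n=1$ or $\varepsilon\ge k$. Precisely: there is an absolute constant $c>0$ and, for every $E>0$, a constant $C>0$ depending only on $E$, such that for all $V$, all $\varepsilon\in(0,E]$ and all integers $k\ge 0$ there is a fully dynamic algorithm (depending only on $V$, $\varepsilon$ and $k$) that, for all $f$ and all $\mathcal M$ of rank $k$ as above, is a $(4+c\varepsilon)$-approximation and has expected amortized running time at most $$C\,\frac{k^2}{\varepsilon}\,\log(k+1)\,\log^2(n+1)\,\log^3\!\left(\frac{k}{\varepsilon}+1\right).$$ -/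

import Mathlib

open scoped ENNReal

universe u v

/-! ### Set functions -/

/-- The marginal gain `f(X | Y) = f(X ∪ Y) - f(Y)`. -/
def marginal {V : Type u} [DecidableEq V] (f : Finset V → ℝ) (X Y : Finset V) : ℝ :=
  f (X ∪ Y) - f Y

/-- `f` is monotone: every element has a nonnegative marginal gain with respect to every set. -/
def IsMonotoneSetFun {V : Type u} [DecidableEq V] (f : Finset V → ℝ) : Prop :=
  ∀ (X : Finset V) (e : V), 0 ≤ marginal f {e} X

/-- `f` is submodular: marginal gains are decreasing. -/
def IsSubmodular {V : Type u} [DecidableEq V] (f : Finset V → ℝ) : Prop :=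
  ∀ (X Y : Finset V), X ⊆ Y → ∀ e : V, e ∉ Y → marginal f {e} Y ≤ marginal f {e} X

open Classical in
/-- The independent subsets of a finite set `A`. -/
noncomputable def indepSubsets {V : Type u} (M : Matroid V) (A : Finset V) :
    Finset (Finset V) :=
  A.powerset.filter fun T => M.Indep (T : Set V)

theorem indepSubsets_nonempty {V : Type u} (M : Matroid V) (A : Finset V) :
    (indepSubsets M A).Nonempty :=
  ⟨∅, by simp [indepSubsets]⟩

/-- `OPT(A)`, the maximum of `f` over the independent subsets of `A`. -/
noncomputable def optValue {V : Type u} (f : Finset V → ℝ) (M : Matroid V) (A : Finset V) : ℝ :=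
  (indepSubsets M A).sup' (indepSubsets_nonempty M A) f

/-! ### Fully dynamic streams -/

/-- An operation of the stream. -/
inductive StreamOp (V : Type u) : Type u
  | insert (e : V) : StreamOp V
  | delete (e : V) : StreamOp V

/-- Effect of an operation on the set of available elements. -/
def StreamOp.apply {V : Type u} [DecidableEq V] (A : Finset V) : StreamOp V → Finset V
  | .insert e => Insert.insert e A
  | .delete e => A.erase e

/-- Only absent elements are inserted and only available elements are deleted.  An element may be
inserted again after it has been deleted. -/
def StreamOp.Legal {V : Type u} (A : Finset V) : StreamOp V → Prop
  | .insert e => e ∉ A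
  | .delete e => e ∈ A

/-- Whether an operation is an insertion. -/
def StreamOp.isInsert {V : Type u} : StreamOp V → Bool
  | .insert _ => true
  | .delete _ => false

/-- The set of elements that were inserted and not deleted during `ops`. -/
def available {V : Type u} [DecidableEq V] (ops : List (StreamOp V)) : Finset V :=
  ops.foldl StreamOp.apply ∅

/-- `ops` is a stream of exactly `n` insertions and `n` deletions, in any legal order. -/
structure IsStream {V : Type u} [DecidableEq V] (n : ℕ) (ops : List (StreamOp V)) : Prop where
  insertions : ops.countP (fun o => o.isInsert) = n
  deletions : ops.countP (fun o => !o.isInsert) = n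
  legal : ∀ (i : ℕ) (hi : i < ops.length), (ops[i]).Legal (available (ops.take i))

/-! ### Randomized computations with a value oracle and an independence oracle -/

/-- A randomized computation that returns an element of `α` and can ask a value oracle for `f(S)`,
ask an independence oracle whether `S` is independent, and draw a uniformly random element of
`{0, …, m}`.  Every computation tree is well-founded, so every run halts. -/
inductive OracleComp (V : Type u) (α : Type v) : Type (max u v)
  | pure (a : α) : OracleComp V α
  | value (S : Finset V) (next : ℝ → OracleComp V α) : OracleComp V α
  | indep (S : Finset V) (next : Bool → OracleComp V α) : OracleComp V α
  | uniform (m : ℕ) (next : Fin (m + 1) → OracleComp V α) : OracleComp V α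

open Classical in
/-- The joint law of the result and of the number of oracle calls (of both kinds), when the
oracles answer according to `f` and `M`. -/
noncomputable def OracleComp.run {V : Type u} {α : Type v} (f : Finset V → ℝ) (M : Matroid V) :
    OracleComp V α → PMF (α × ℕ)
  | .pure a => PMF.pure (a, 0)
  | .value S next => ((next (f S)).run f M).map fun x => (x.1, x.2 + 1)
  | .indep S next =>
      ((next (decide (M.Indep (S : Set V)))).run f M).map fun x => (x.1, x.2 + 1)
  | .uniform m next =>
      (PMF.uniformOfFintype (Fin (m + 1))).bind fun i => (next i).run f M

/-! ### Dynamic algorithms -/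

/-- A randomized fully dynamic algorithm on the ground set `V`: it keeps a state, which carries the
current solution, and processes the operations one at a time.  It sees the operations only as they
arrive, and the function and the matroid only through oracle calls. -/
structure DynamicAlgorithm (V : Type u) : Type (u + 1) where
  State : Type u
  init : State
  update : State → StreamOp V → OracleComp V State
  solution : State → Finset V

namespace DynamicAlgorithm

variable {V : Type u} [DecidableEq V]

/-- The joint law of the state after the operations `ops` and of the total number of oracle calls
made while processing them. -/
noncomputable def run (alg : DynamicAlgorithm V) (f : Finset V → ℝ) (M : Matroid V)
    (ops : List (StreamOp V)) : PMF (alg.State × ℕ) :=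
  ops.foldl
    (fun p o => p.bind fun x =>
      ((alg.update x.1 o).run f M).map fun y => (y.1, x.2 + y.2))
    (PMF.pure (alg.init, 0))

/-- The expected total running time (number of oracle calls) on the stream `ops`. -/
noncomputable def expectedTime (alg : DynamicAlgorithm V) (f : Finset V → ℝ) (M : Matroid V)
    (ops : List (StreamOp V)) : ℝ≥0∞ :=
  ∑' x : alg.State × ℕ, alg.run f M ops x * (x.2 : ℝ≥0∞)

/-- On every stream fixed in advance, after each operation and for every outcome of the random
choices, the maintained solution is feasible and is an `a`-approximation of the optimum over the
available elements. -/
def IsApproximation (alg : DynamicAlgorithm V) (f : Finset V → ℝ) (M : Matroid V) (a : ℝ) : Prop :=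
  ∀ (n : ℕ) (ops : List (StreamOp V)), IsStream n ops → ∀ i ≤ 2 * n,
    ∀ x ∈ (alg.run f M (ops.take i)).support,
      alg.solution x.1 ⊆ available (ops.take i) ∧
      M.Indep (alg.solution x.1 : Set V) ∧
      optValue f M (available (ops.take i)) ≤ a * f (alg.solution x.1)

/-- The expected total running time on every stream of `n` insertions and `n` deletions is at most
`2 n t(n)`. -/
def HasAmortizedTime (alg : DynamicAlgorithm V) (f : Finset V → ℝ) (M : Matroid V)
    (t : ℕ → ℝ) : Prop :=
  ∀ (n : ℕ) (ops : List (StreamOp V)), IsStream n ops →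
    alg.expectedTime f M ops ≤ ENNReal.ofReal (2 * n * t n)

end DynamicAlgorithm

/-! The algorithm keeps a uniformly random ordering of the available elements, reruns a
deterministic static algorithm on it after each operation, and remembers every oracle answer. Only
oracle calls count as time, so an update costs at most the number of queries asked on the new
ordering but not on the old one. As the stream is fixed in advance, inserting at a uniform position
and erasing both keep the ordering uniform. The approximation is deterministic, since the static
algorithm is correct on every list. What remains is a static algorithm of ratio `4 + ε` whose query
set hardly changes, on average, when one element is removed from a random list.

At a threshold `θ` the static algorithm repeatedly filters the list by a test and accepts the first
survivor. An accepted element gets its marginal value as weight and enters the solution freely, or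
replaces an element of at most half its weight. Hence the value of all accepted elements is at most
`2 f(sol)`. An element whose marginal value is at least `θ` fails the test only if solution elements
of weight above half its marginal value span it. Hall's theorem matches such elements of an optimum
injectively to solution elements, so their marginal values total at most another `2 f(sol)`; the
others lose at most `k θ`. Spans of heavy elements never shrink, so rejection is permanent
(`Valid.closure_heavy_subset`, `Valid.rejected_next`). A logarithmic potential gains 1 per
acceptance and is at most `k (h + 1)` when values are at most `2 ^ h θ`; this bounds the number of
rounds.

For stability (`orderAvg_greedyQueries_le`), an element `x` of a random list of `m` survivors is
accepted next with probability `1 / m`. Only then may everything afterwards change, at a cost linear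
in `m`, so the expected cost per round does not depend on `m`. Otherwise only the two test queries
of `x` differ in that round.

The right threshold depends on the largest value of a single element, which updates change.
Therefore all thresholds `2 ^ (j - h)` are processed, each on the elements of scale in `[j - h, j]`;
a given element affects `h + 1` of them. With `2 ^ h` about `16 k / ε`, the expected cost per update
is `O(k² (h + 2)³)`, independent of `n`; the remaining factors of the claimed bound are bounded
below by constants. -/

/-! ### Deterministic query programs -/

/-- A query to the value oracle (`inl S`) or to the independence oracle (`inr S`). -/
abbrev OracleQuery (V : Type u) : Type u := Finset V ⊕ Finset V

open Classical in
/-- The true answers of the oracles; an independence query is answered by `1` or `0`. -/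
noncomputable def oracleAnswer {V : Type u} (f : Finset V → ℝ) (M : Matroid V) :
    OracleQuery V → ℝ
  | .inl S => f S
  | .inr S => if M.Indep (S : Set V) then 1 else 0

/-- A deterministic computation that asks oracle queries. -/
inductive QueryTree (V : Type u) (α : Type v) : Type (max u v)
  | pure (a : α) : QueryTree V α
  | ask (q : OracleQuery V) (next : ℝ → QueryTree V α) : QueryTree V α

namespace QueryTree

variable {V : Type u} {α β : Type*} {ι : Type*}

/-- The result of a computation when the oracles answer according to `ans`. -/
def eval (ans : OracleQuery V → ℝ) : QueryTree V α → α
  | .pure a => a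
  | .ask q next => (next (ans q)).eval ans

/-- The queries that are asked when the oracles answer according to `ans`. -/
def queries [DecidableEq V] (ans : OracleQuery V → ℝ) :
    QueryTree V α → Finset (OracleQuery V)
  | .pure _ => ∅
  | .ask q next => insert q ((next (ans q)).queries ans)

/-- Sequential composition. -/
def bind : QueryTree V α → (α → QueryTree V β) → QueryTree V β
  | .pure a, g => g a
  | .ask q next, g => .ask q fun r => (next r).bind g

/-- Keep the results `g y` that are not `none`, for `y` in a list. -/
def filterMap (g : ι → QueryTree V (Option β)) : List ι → QueryTree V (List β)
  | [] => .pure []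
  | y :: l => (g y).bind fun b => (filterMap g l).bind fun L => .pure (b.toList ++ L)

/-- Run `g y` for all `y` in a list, and then `t`. -/
def forEach (g : ι → QueryTree V α) (t : QueryTree V β) : List ι → QueryTree V β
  | [] => t
  | y :: l => (g y).bind fun _ => forEach g t l

variable (ans : OracleQuery V → ℝ)

@[simp] theorem eval_pure (a : α) : (pure a : QueryTree V α).eval ans = a := rfl

@[simp] theorem eval_ask (q : OracleQuery V) (next : ℝ → QueryTree V α) :
    (ask q next).eval ans = (next (ans q)).eval ans := rfl

@[simp] theorem eval_bind (t : QueryTree V α) (g : α → QueryTree V β) :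
    (t.bind g).eval ans = (g (t.eval ans)).eval ans := by
  induction t with
  | pure a => rfl
  | ask q next ih => exact ih _

@[simp] theorem eval_filterMap (g : ι → QueryTree V (Option β)) (l : List ι) :
    (filterMap g l).eval ans = l.filterMap fun y => (g y).eval ans := by
  induction l with
  | nil => rfl
  | cons y l ih =>
    simp only [filterMap, eval_bind, ih, eval_pure, List.filterMap_cons]
    cases (g y).eval ans <;> rfl

@[simp] theorem eval_forEach (g : ι → QueryTree V α) (t : QueryTree V β) (l : List ι) :
    (forEach g t l).eval ans = t.eval ans := by
  induction l with
  | nil => rfl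
  | cons y l ih => simp [forEach, ih]

variable [DecidableEq V]

@[simp] theorem queries_pure (a : α) : (pure a : QueryTree V α).queries ans = ∅ := rfl

@[simp] theorem queries_ask (q : OracleQuery V) (next : ℝ → QueryTree V α) :
    (ask q next).queries ans = insert q ((next (ans q)).queries ans) := rfl

@[simp] theorem queries_bind (t : QueryTree V α) (g : α → QueryTree V β) :
    (t.bind g).queries ans = t.queries ans ∪ (g (t.eval ans)).queries ans := by
  induction t with
  | pure a => simp [bind]
  | ask q next ih => simp [bind, ih]

theorem mem_queries_filterMap {g : ι → QueryTree V (Option β)} {l : List ι}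
    {q : OracleQuery V} :
    q ∈ (filterMap g l).queries ans ↔ ∃ y ∈ l, q ∈ (g y).queries ans := by
  induction l with
  | nil => simp [filterMap]
  | cons y l ih => simp [filterMap, ih]

theorem mem_queries_forEach {g : ι → QueryTree V α} {t : QueryTree V β} {l : List ι}
    {q : OracleQuery V} :
    q ∈ (forEach g t l).queries ans ↔
      (∃ y ∈ l, q ∈ (g y).queries ans) ∨ q ∈ t.queries ans := by
  induction l with
  | nil => simp [forEach]
  | cons y l ih => simp [forEach, ih, or_assoc]

end QueryTree

/-! ### Memoized execution -/

/-- A partial table of answers. -/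
abbrev AnswerTable (V : Type u) : Type u := OracleQuery V → Option ℝ

namespace QueryTree

variable {V : Type u} [DecidableEq V] {α : Type v} {β : Type u}

/-- Ask a query and continue with its numerical answer. -/
noncomputable def _root_.OracleComp.askQuery (q : OracleQuery V) (next : ℝ → OracleComp V β) :
    OracleComp V β :=
  match q with
  | .inl S => .value S next
  | .inr S => .indep S fun b => next (if b then 1 else 0)

/-- Run a computation, asking only the queries whose answer is not in the table `T`, and return
`g` of the result and of the extended table. -/
noncomputable def memo (g : α → AnswerTable V → β) :
    QueryTree V α → AnswerTable V → OracleComp V β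
  | .pure a, T => .pure (g a T)
  | .ask q next, T =>
    match T q with
    | some r => (next r).memo g T
    | none =>
      .askQuery q fun r => (next r).memo g (Function.update T q (some r))

variable (f : Finset V → ℝ) (M : Matroid V)

/-- The entries of the table are true answers. -/
def TableValid (T : AnswerTable V) : Prop := ∀ q r, T q = some r → r = oracleAnswer f M q

theorem TableValid.update {T : AnswerTable V} (hT : TableValid f M T) (q : OracleQuery V) :
    TableValid f M (Function.update T q (some (oracleAnswer f M q))) := by
  intro q' r h
  by_cases hq : q' = q
  · subst hq; simpa using h.symm
  · rw [Function.update_of_ne hq] at h; exact hT _ _ h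

omit [DecidableEq V] in
theorem _root_.OracleComp.run_askQuery (q : OracleQuery V) (next : ℝ → OracleComp V β) :
    (OracleComp.askQuery q next).run f M =
      ((next (oracleAnswer f M q)).run f M).map fun x => (x.1, x.2 + 1) := by
  cases q with
  | inl S => rfl
  | inr S =>
    by_cases h : M.Indep (S : Set V) <;> simp [OracleComp.askQuery, OracleComp.run, oracleAnswer, h]

/-- True answers in the table make the memoized run follow the same path as `eval`. Each new answer
is stored at once, so a repeated query is free and the cost is bounded by a number of distinct
queries. -/
theorem run_memo (g : α → AnswerTable V → β) (t : QueryTree V α) :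
    ∀ T : AnswerTable V, TableValid f M T → ∃ (T' : AnswerTable V) (m : ℕ),
      (t.memo g T).run f M = PMF.pure (g (t.eval (oracleAnswer f M)) T', m) ∧
      TableValid f M T' ∧
      (∀ q, T q ≠ none ∨ q ∈ t.queries (oracleAnswer f M) → T' q ≠ none) ∧
      m ≤ ((t.queries (oracleAnswer f M)).filter fun q => T q = none).card := by
  induction t with
  | pure a => exact fun T hT => ⟨T, 0, rfl, hT, by simp, by simp⟩
  | ask q next ih =>
    intro T hT
    cases hq : T q with
    | some r =>
      obtain rfl := hT _ _ hq
      obtain ⟨T', m, h1, h2, h3, h4⟩ := ih (oracleAnswer f M q) T hT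
      refine ⟨T', m, ?_, h2, ?_, h4.trans (Finset.card_le_card ?_)⟩
      · rw [memo, hq]; exact h1
      · rintro q' (h | h)
        · exact h3 _ (.inl h)
        · rcases Finset.mem_insert.1 h with rfl | h
          · exact h3 _ (.inl (by simp [hq]))
          · exact h3 _ (.inr h)
      · exact Finset.filter_subset_filter _ (Finset.subset_insert _ _)
    | none =>
      obtain ⟨T', m, h1, h2, h3, h4⟩ := ih (oracleAnswer f M q) _ (hT.update f M q)
      refine ⟨T', m + 1, ?_, h2, ?_, ?_⟩
      · rw [memo, hq]
        simp only
        rw [OracleComp.run_askQuery, h1, PMF.pure_map]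
        rfl
      · rintro q' (h | h)
        · refine h3 _ (.inl ?_)
          rwa [Function.update_of_ne]
          rintro rfl; exact h hq
        · by_cases hq' : q' = q
          · subst hq'; exact h3 _ (.inl (by simp))
          · exact h3 _ (.inr ((Finset.mem_insert.1 h).resolve_left hq'))
      · rw [← Nat.lt_iff_add_one_le]
        refine h4.trans_lt (Finset.card_lt_card ⟨?_, fun hs => ?_⟩)
        · intro q' h
          rw [Finset.mem_filter] at h ⊢
          by_cases hq' : q' = q
          · subst hq'; simp at h
          · rw [Function.update_of_ne hq'] at h
            exact ⟨Finset.mem_insert_of_mem h.1, h.2⟩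
        · have := hs (Finset.mem_filter.2 ⟨Finset.mem_insert_self q _, hq⟩)
          simp at this

end QueryTree

/-! ### Averages over the orderings of a finite set -/

/-- The orderings of a finite set. -/
def orderings {V : Type u} (A : Finset V) : Finset (List V) :=
  ⟨A.val.lists, Multiset.lists_nodup_finset A⟩

section Orderings

variable {V : Type u} [DecidableEq V]

theorem mem_orderings {A : Finset V} {l : List V} :
    l ∈ orderings A ↔ l.Nodup ∧ l.toFinset = A := by
  rw [orderings, Finset.mem_mk, Multiset.mem_lists_iff]
  constructor
  · intro h
    have hl : l.Nodup := by
      have := A.nodup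
      rw [h] at this
      exact this
    refine ⟨hl, Finset.val_injective ?_⟩
    rw [h, List.toFinset_val, hl.dedup]
    rfl
  · rintro ⟨h, rfl⟩
    rw [List.toFinset_val, h.dedup]
    rfl

theorem length_of_mem_orderings {A : Finset V} {l : List V} (h : l ∈ orderings A) :
    l.length = A.card := by
  obtain ⟨h1, rfl⟩ := mem_orderings.1 h
  exact (List.toFinset_card_of_nodup h1).symm

theorem mem_of_mem_orderings {A : Finset V} {l : List V} (h : l ∈ orderings A) {x : V} :
    x ∈ l ↔ x ∈ A := by
  rw [← (mem_orderings.1 h).2, List.mem_toFinset]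

omit [DecidableEq V] in
theorem card_orderings (A : Finset V) : (orderings A).card = A.card.factorial := by
  obtain ⟨l, hl⟩ : ∃ l : List V, A.val = l := ⟨A.toList, by simp⟩
  have : (orderings A).card = (Multiset.lists A.val).card := rfl
  rw [this, Finset.card_def, hl, Multiset.lists_coe, Multiset.coe_card, List.length_permutations,
    Multiset.coe_card]

theorem orderings_empty : orderings (∅ : Finset V) = {[]} := by
  ext l
  simp [mem_orderings, List.toFinset_eq_empty_iff]
  rintro rfl; simp

theorem perm_insertIdx_mem_orderings {A : Finset V} {x : V} (hx : x ∉ A) {l : List V}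
    (hl : l ∈ orderings A) {i : ℕ} (hi : i ≤ l.length) :
    l.insertIdx i x ∈ orderings (insert x A) := by
  have hp := List.perm_insertIdx x l hi
  obtain ⟨h1, rfl⟩ := mem_orderings.1 hl
  rw [mem_orderings, hp.nodup_iff, List.toFinset_eq_of_perm _ _ hp, List.toFinset_cons,
    List.nodup_cons]
  exact ⟨⟨by simpa using hx, h1⟩, rfl⟩

theorem erase_mem_orderings {A : Finset V} {x : V} {l : List V} (hl : l ∈ orderings A) :
    l.erase x ∈ orderings (A.erase x) := by
  obtain ⟨h1, rfl⟩ := mem_orderings.1 hl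
  refine mem_orderings.2 ⟨h1.erase x, ?_⟩
  ext y
  simp [h1.mem_erase_iff]

theorem erase_insertIdx_self {x : V} {l : List V} (hx : x ∉ l) {i : ℕ} (hi : i ≤ l.length) :
    (l.insertIdx i x).erase x = l := by
  induction l generalizing i with
  | nil => obtain rfl : i = 0 := by simpa using hi
           simp
  | cons y l ih =>
    cases i with
    | zero => simp
    | succ i =>
      rw [List.insertIdx_succ_cons, List.erase_cons_tail, ih (by simp_all) (by simpa using hi)]
      simp only [beq_iff_eq]; rintro rfl; simp at hx

theorem insertIdx_idxOf_erase {x : V} {l : List V} (hx : x ∈ l) :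
    (l.erase x).insertIdx (l.idxOf x) x = l := by
  induction l with
  | nil => simp at hx
  | cons y l ih =>
    by_cases h : y = x
    · subst h; simp
    · rw [List.erase_cons_tail (by simpa using h), List.idxOf_cons_ne _ h,
        List.insertIdx_succ_cons, ih ((List.mem_cons.1 hx).resolve_left (Ne.symm h))]

theorem idxOf_insertIdx_self {x : V} {l : List V} (hx : x ∉ l) {i : ℕ} (hi : i ≤ l.length) :
    (l.insertIdx i x).idxOf x = i := by
  induction l generalizing i with
  | nil => obtain rfl : i = 0 := by simpa using hi
           simp
  | cons y l ih =>
    cases i with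
    | zero => simp
    | succ i =>
      rw [List.insertIdx_succ_cons, List.idxOf_cons_ne, ih (by simp_all) (by simpa using hi)]
      rintro rfl; simp at hx

/-- An ordering of `insert x A` amounts to an ordering of `A` and a position for `x`; erasing `x`
and recording its index is the inverse. -/
theorem sum_orderings_insert {A : Finset V} {x : V} (hx : x ∉ A) (g : List V → ℝ≥0∞) :
    ∑ l ∈ orderings A, ∑ i : Fin (A.card + 1), g (l.insertIdx i x) =
      ∑ l ∈ orderings (insert x A), g l := by
  rw [← Finset.sum_product']
  refine Finset.sum_bij' (fun p _ => p.1.insertIdx p.2 x)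
    -- The minimum only serves to land in `Fin (A.card + 1)`; on an ordering of `insert x A` it
    -- equals the index.
    (fun l hl => (l.erase x, ⟨min (l.idxOf x) A.card, by omega⟩)) ?_ ?_ ?_ ?_ ?_
  · rintro ⟨l, i⟩ h
    have hl := (Finset.mem_product.1 h).1
    exact perm_insertIdx_mem_orderings hx hl
      (by rw [length_of_mem_orderings hl]; exact Nat.lt_succ_iff.1 i.2)
  · intro l hl
    have := erase_mem_orderings (x := x) hl
    rw [Finset.erase_insert hx] at this
    simpa using this
  · rintro ⟨l, i⟩ h
    have hl := (Finset.mem_product.1 h).1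
    have hi : (i : ℕ) ≤ l.length := by
      rw [length_of_mem_orderings hl]; exact Nat.lt_succ_iff.1 i.2
    have hxl : x ∉ l := by rwa [mem_of_mem_orderings hl]
    refine Prod.ext (erase_insertIdx_self hxl hi) (Fin.ext ?_)
    simp only [idxOf_insertIdx_self hxl hi]
    rw [length_of_mem_orderings hl] at hi
    omega
  · intro l hl
    have hxl : x ∈ l := by rw [mem_of_mem_orderings hl]; simp
    have h1 := List.idxOf_lt_length_of_mem hxl
    have h2 := length_of_mem_orderings hl
    rw [Finset.card_insert_of_notMem hx] at h2
    have : min (l.idxOf x) A.card = l.idxOf x := by omega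
    simp only [this]
    exact insertIdx_idxOf_erase hxl
  · simp

theorem sum_orderings_erase {A : Finset V} {x : V} (hx : x ∈ A) (g : List V → ℝ≥0∞) :
    ∑ l ∈ orderings A, g (l.erase x) = A.card * ∑ l ∈ orderings (A.erase x), g l := by
  have h := sum_orderings_insert (Finset.notMem_erase x A) fun l => g (l.erase x)
  rw [Finset.insert_erase hx] at h
  rw [← h, Finset.mul_sum]
  refine Finset.sum_congr rfl fun l hl => ?_
  have hxl : x ∉ l := by rw [mem_of_mem_orderings hl]; simp
  have hc : (A.erase x).card + 1 = A.card := Finset.card_erase_add_one hx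
  rw [Finset.sum_congr rfl fun i _ => by
    rw [erase_insertIdx_self hxl (by
      rw [length_of_mem_orderings hl]; exact Nat.lt_succ_iff.1 i.2)]]
  simp only [Finset.sum_const, Finset.card_univ, Fintype.card_fin, hc, nsmul_eq_mul]

theorem sum_orderings_cons {A : Finset V} (hA : A.Nonempty) (g : List V → ℝ≥0∞) :
    ∑ l ∈ orderings A, g l = ∑ e ∈ A, ∑ t ∈ orderings (A.erase e), g (e :: t) := by
  rw [Finset.sum_sigma']
  symm
  refine Finset.sum_bij (fun p _ => p.1 :: p.2) ?_ ?_ ?_ ?_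
  · rintro ⟨e, t⟩ h
    obtain ⟨he, ht⟩ := Finset.mem_sigma.1 h
    obtain ⟨h1, h2⟩ := mem_orderings.1 ht
    refine mem_orderings.2 ⟨List.nodup_cons.2 ⟨?_, h1⟩, ?_⟩
    · rw [mem_of_mem_orderings ht]; simp
    · simp only [List.toFinset_cons, h2]; exact Finset.insert_erase he
  · rintro ⟨e, t⟩ _ ⟨e', t'⟩ _ h
    simp only [List.cons.injEq] at h
    obtain ⟨rfl, rfl⟩ := h
    rfl
  · intro l hl
    obtain ⟨h1, h2⟩ := mem_orderings.1 hl
    cases l with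
    | nil => simp at h2; subst h2; simp at hA
    | cons e t =>
      refine ⟨⟨e, t⟩, Finset.mem_sigma.2 ⟨?_, ?_⟩, rfl⟩
      · rw [← h2]; simp
      · have := erase_mem_orderings (x := e) hl
        simpa using this
  · simp

/-! ### Uniformly random orderings under insertion, deletion, restriction and conditioning on the
head -/

/-- The average of `g` over the orderings of `A`. -/
noncomputable def orderAvg (A : Finset V) (g : List V → ℝ≥0∞) : ℝ≥0∞ :=
  (∑ l ∈ orderings A, g l) / (A.card.factorial : ℝ≥0∞)

theorem factorial_cast_ne_zero (n : ℕ) : (n.factorial : ℝ≥0∞) ≠ 0 := by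
  exact_mod_cast n.factorial_ne_zero

omit [DecidableEq V] in
theorem orderAvg_mono {A : Finset V} {g h : List V → ℝ≥0∞}
    (H : ∀ l ∈ orderings A, g l ≤ h l) : orderAvg A g ≤ orderAvg A h :=
  ENNReal.div_le_div_right (Finset.sum_le_sum H) _

omit [DecidableEq V] in
theorem orderAvg_congr {A : Finset V} {g h : List V → ℝ≥0∞}
    (H : ∀ l ∈ orderings A, g l = h l) : orderAvg A g = orderAvg A h := by
  rw [orderAvg, orderAvg, Finset.sum_congr rfl H]

omit [DecidableEq V] in
theorem orderAvg_add (A : Finset V) (g h : List V → ℝ≥0∞) :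
    orderAvg A (fun l => g l + h l) = orderAvg A g + orderAvg A h := by
  simp only [orderAvg, Finset.sum_add_distrib, ENNReal.add_div]

omit [DecidableEq V] in
theorem orderAvg_sum {ι : Type*} (s : Finset ι) (A : Finset V) (g : ι → List V → ℝ≥0∞) :
    orderAvg A (fun l => ∑ i ∈ s, g i l) = ∑ i ∈ s, orderAvg A (g i) := by
  simp only [orderAvg, div_eq_mul_inv]
  rw [Finset.sum_comm, Finset.sum_mul]

omit [DecidableEq V] in
theorem orderAvg_const (A : Finset V) (c : ℝ≥0∞) : orderAvg A (fun _ => c) = c := by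
  rw [orderAvg, Finset.sum_const, card_orderings, nsmul_eq_mul, mul_comm]
  exact ENNReal.mul_div_cancel_right (factorial_cast_ne_zero _) (ENNReal.natCast_ne_top _)

omit [DecidableEq V] in
theorem orderAvg_le {A : Finset V} {g : List V → ℝ≥0∞} {c : ℝ≥0∞}
    (H : ∀ l ∈ orderings A, g l ≤ c) : orderAvg A g ≤ c :=
  (orderAvg_mono H).trans (orderAvg_const A c).le

theorem orderAvg_empty (g : List V → ℝ≥0∞) : orderAvg ∅ g = g [] := by
  simp [orderAvg, orderings_empty]

theorem orderAvg_insert {A : Finset V} {x : V} (hx : x ∉ A) (g : List V → ℝ≥0∞) :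
    orderAvg A (fun l => ∑ i : Fin (A.card + 1), g (l.insertIdx i x) / ((A.card + 1 : ℕ) : ℝ≥0∞)) =
      orderAvg (insert x A) g := by
  simp only [orderAvg, div_eq_mul_inv, ← Finset.sum_mul]
  rw [sum_orderings_insert hx, Finset.card_insert_of_notMem hx, Nat.factorial_succ, mul_assoc,
    Nat.cast_mul, ENNReal.mul_inv (.inr (ENNReal.natCast_ne_top _))
      (.inl (ENNReal.natCast_ne_top _))]

theorem orderAvg_erase {A : Finset V} {x : V} (hx : x ∈ A) (g : List V → ℝ≥0∞) :
    orderAvg A (fun l => g (l.erase x)) = orderAvg (A.erase x) g := by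
  rw [orderAvg, orderAvg, sum_orderings_erase hx, ← Finset.card_erase_add_one hx,
    Nat.factorial_succ, Nat.cast_mul]
  exact ENNReal.mul_div_mul_left _ _ (by simp) (ENNReal.natCast_ne_top _)

/-- A random ordering restricted to a fixed subset is again uniform: the elements outside the subset
can be erased one at a time. This is why the survivors of a test are still in random order. -/
theorem orderAvg_filter (p : V → Prop) [DecidablePred p] (g : List V → ℝ≥0∞) (A : Finset V) :
    orderAvg A (fun l => g (l.filter p)) = orderAvg (A.filter p) g := by
  induction A using Finset.strongInduction with
  | H A ih =>
    by_cases h : ∀ x ∈ A, p x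
    · rw [Finset.filter_true_of_mem h]
      refine orderAvg_congr fun l hl => ?_
      rw [List.filter_eq_self.2]
      intro x hx
      simpa using h x ((mem_of_mem_orderings hl).1 hx)
    · push Not at h
      obtain ⟨x, hx, hpx⟩ := h
      have h1 : ∀ l : List V, (l.erase x).filter p = l.filter p := fun l => by
        induction l with
        | nil => rfl
        | cons y l ih =>
          by_cases hy : y = x
          · subst hy; simp [hpx]
          · rw [List.erase_cons_tail (by simpa using hy), List.filter_cons, List.filter_cons, ih]
      have h2 : (A.erase x).filter p = A.filter p := by
        rw [Finset.filter_erase, Finset.erase_eq_of_notMem]; simp [hpx]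
      have h3 := orderAvg_erase hx fun l => g (l.filter p)
      simp only [h1] at h3
      rw [h3, ih _ (Finset.erase_ssubset hx), h2]

/-- The head is uniform in `A`, and given the head the tail is a uniform ordering of the rest; this
allows induction on the rounds of the process. -/
theorem orderAvg_cons {A : Finset V} (hA : A.Nonempty) (g : List V → ℝ≥0∞) :
    orderAvg A g = (∑ e ∈ A, orderAvg (A.erase e) fun t => g (e :: t)) / (A.card : ℝ≥0∞) := by
  obtain ⟨n, hn⟩ := Nat.exists_eq_succ_of_ne_zero hA.card_ne_zero
  have h : ∀ e ∈ A, orderAvg (A.erase e) (fun t => g (e :: t)) =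
      (∑ t ∈ orderings (A.erase e), g (e :: t)) / (n.factorial : ℝ≥0∞) := fun e he => by
    rw [orderAvg, Finset.card_erase_of_mem he, hn, Nat.succ_sub_one]
  rw [Finset.sum_congr rfl h, orderAvg, sum_orderings_cons hA]
  simp only [div_eq_mul_inv, ← Finset.sum_mul]
  rw [hn, Nat.factorial_succ, mul_assoc, Nat.cast_mul,
    ENNReal.mul_inv (.inr (ENNReal.natCast_ne_top _)) (.inl (ENNReal.natCast_ne_top _)),
    mul_comm ((n.factorial : ℝ≥0∞)⁻¹)]

end Orderings

/-! ### Sensitivity of a random-order greedy process -/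

section Greedy

variable {V : Type u} [DecidableEq V] {σ Q : Type*} [DecidableEq Q]

theorem Finset.card_symmDiff_le_card_add_card (A B : Finset Q) :
    (symmDiff A B).card ≤ A.card + B.card :=
  (Finset.card_le_card (fun q => by simp only [Finset.mem_symmDiff, Finset.mem_union]; tauto)).trans
    (Finset.card_union_le A B)

theorem Finset.card_symmDiff_union_le (A B A' B' : Finset Q) :
    (symmDiff (A ∪ B) (A' ∪ B')).card ≤ (symmDiff A A').card + (symmDiff B B').card :=
  (Finset.card_le_card (fun q => by
    simp only [Finset.mem_symmDiff, Finset.mem_union]; tauto)).trans (Finset.card_union_le _ _)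

/-- The queries asked by a process with state `s` that accepts the first promising element `e` of
the list, discards the elements that are not promising, and continues in state `acc s e` with the
rest of the list, for at most `n` rounds.  Testing `y` asks `tq s y` and accepting `e` asks
`aq s e`. -/
def greedyQueries (prom : σ → V → Bool) (acc : σ → V → σ) (tq aq : σ → V → Finset Q) :
    ℕ → σ → List V → Finset Q
  | 0, _, _ => ∅
  | n + 1, s, l => l.toFinset.biUnion (tq s) ∪
      match l.filter (prom s) with
      | [] => ∅
      | e :: t => aq s e ∪ greedyQueries prom acc tq aq n (acc s e) t

/-- The queries asked in one round after the tests, given the list of promising elements. -/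
def greedyHeadQueries (prom : σ → V → Bool) (acc : σ → V → σ) (tq aq : σ → V → Finset Q)
    (n : ℕ) (s : σ) : List V → Finset Q
  | [] => ∅
  | e :: t => aq s e ∪ greedyQueries prom acc tq aq n (acc s e) t

variable (prom : σ → V → Bool) (acc : σ → V → σ) (tq aq : σ → V → Finset Q)

theorem greedyQueries_succ (n : ℕ) (s : σ) (l : List V) :
    greedyQueries prom acc tq aq (n + 1) s l =
      l.toFinset.biUnion (tq s) ∪
        greedyHeadQueries prom acc tq aq n s (l.filter (prom s)) := by
  rw [greedyQueries]
  cases l.filter (prom s) <;> rfl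

@[simp] theorem greedyQueries_nil (n : ℕ) (s : σ) :
    greedyQueries prom acc tq aq n s [] = ∅ := by
  cases n <;> simp [greedyQueries]

variable {Inv : σ → Prop} (hacc : ∀ s e, Inv s → Inv (acc s e))
  (htq : ∀ s y, (tq s y).card ≤ 2) {a : ℕ} (haq : ∀ s e, Inv s → (aq s e).card ≤ a)

include hacc htq haq

theorem card_greedyQueries_le (n : ℕ) (s : σ) (hs : Inv s) (l : List V) :
    (greedyQueries prom acc tq aq n s l).card ≤ n * (2 * l.length + a) := by
  induction n generalizing s l with
  | zero => simp [greedyQueries]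
  | succ n ih =>
    rw [greedyQueries_succ]
    have h1 : (l.toFinset.biUnion (tq s)).card ≤ l.length * 2 :=
      (Finset.card_biUnion_le_card_mul _ _ 2 fun y _ => htq s y).trans
        (Nat.mul_le_mul_right _ (List.toFinset_card_le l))
    have h2 : (greedyHeadQueries prom acc tq aq n s (l.filter (prom s))).card ≤
        a + n * (2 * l.length + a) := by
      have hlen := List.length_filter_le (prom s) l
      cases hl : l.filter (prom s) with
      | nil => simp [greedyHeadQueries]
      | cons e t =>
        rw [hl, List.length_cons] at hlen
        refine (Finset.card_union_le _ _).trans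
          (add_le_add (haq s e hs) ((ih _ (hacc s e hs) t).trans ?_))
        gcongr
        omega
    refine (Finset.card_union_le _ _).trans ((add_le_add h1 h2).trans (le_of_eq ?_))
    ring

theorem card_greedyHeadQueries_le (n : ℕ) (s : σ) (hs : Inv s) (l : List V) :
    (greedyHeadQueries prom acc tq aq n s l).card ≤ a + n * (2 * l.length + a) := by
  cases l with
  | nil => simp [greedyHeadQueries]
  | cons e t =>
    refine (Finset.card_union_le _ _).trans (add_le_add (haq s e hs)
      ((card_greedyQueries_le prom acc tq aq hacc htq haq n _ (hacc s e hs) t).trans ?_))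
    gcongr
    simp

/-- If the accepted head is not `x`, both runs continue from the same state and `ih` applies to the
tail. If it is `x`, both query sets are bounded crudely, by `2 * N * a + 4 * N * R.card` together;
this has weight `1 / R.card`, which cancels the size of `R`. By `hb` the term `2 * N * a` is already
part of `b`, so it is paid once and not in each round. -/
theorem orderAvg_greedyHeadQueries_le {N n : ℕ} (hn : n + 1 ≤ N) (x : V) (b : ℝ≥0∞)
    (hb : (2 * N * a : ℕ) ≤ b)
    (ih : ∀ s, Inv s → ∀ R : Finset V, x ∈ R →
      orderAvg R (fun l => ((symmDiff (greedyQueries prom acc tq aq n s l)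
        (greedyQueries prom acc tq aq n s (l.erase x))).card : ℝ≥0∞)) ≤ b)
    (s : σ) (hs : Inv s) (R : Finset V) :
    orderAvg R (fun l => ((symmDiff (greedyHeadQueries prom acc tq aq n s l)
        (greedyHeadQueries prom acc tq aq n s (l.erase x))).card : ℝ≥0∞)) ≤ b + 4 * N := by
  by_cases hx : x ∈ R
  · rw [orderAvg_cons ⟨x, hx⟩]
    refine ENNReal.div_le_of_le_mul ?_
    have key : ∀ e ∈ R, orderAvg (R.erase e) (fun t =>
        ((symmDiff (greedyHeadQueries prom acc tq aq n s (e :: t))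
          (greedyHeadQueries prom acc tq aq n s ((e :: t).erase x))).card : ℝ≥0∞)) ≤
        b + if e = x then (4 * N * R.card : ℝ≥0∞) else 0 := by
      intro e he
      by_cases hex : e = x
      · subst hex
        rw [if_pos rfl]
        refine orderAvg_le fun t ht => ?_
        rw [List.erase_cons_head]
        have h1 := card_greedyHeadQueries_le prom acc tq aq hacc htq haq n s hs t
        have h2 : (greedyHeadQueries prom acc tq aq n s (e :: t)).card ≤ _ :=
          (Finset.card_union_le _ _).trans (add_le_add (haq s e hs)
            (card_greedyQueries_le prom acc tq aq hacc htq haq n _ (hacc s e hs) t))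
        have h3 := Finset.card_symmDiff_le_card_add_card
          (greedyHeadQueries prom acc tq aq n s (e :: t)) (greedyHeadQueries prom acc tq aq n s t)
        have h4 : t.length ≤ R.card := by
          rw [length_of_mem_orderings ht]; exact Finset.card_le_card (Finset.erase_subset _ _)
        -- The `n` remaining rounds and the acceptance of the head together cost at most `N` terms
        -- `a`.
        have h5 : a + n * (2 * t.length + a) ≤ N * a + 2 * N * R.card :=
          calc a + n * (2 * t.length + a) = (n + 1) * a + 2 * n * t.length := by ring
            _ ≤ N * a + 2 * N * R.card := by gcongr; omega
        have h6 : (symmDiff (greedyHeadQueries prom acc tq aq n s (e :: t))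
            (greedyHeadQueries prom acc tq aq n s t)).card ≤ 2 * N * a + 4 * N * R.card := by
          have : 2 * (N * a + 2 * N * R.card) = 2 * N * a + 4 * N * R.card := by ring
          omega
        calc _ ≤ ((2 * N * a + 4 * N * R.card : ℕ) : ℝ≥0∞) := by exact_mod_cast h6
          _ = ((2 * N * a : ℕ) : ℝ≥0∞) + 4 * N * R.card := by push_cast; rfl
          _ ≤ _ := by gcongr
      · rw [if_neg hex, add_zero]
        refine (orderAvg_mono fun t _ => ?_).trans
          (ih (acc s e) (hacc s e hs) (R.erase e) (Finset.mem_erase.2 ⟨Ne.symm hex, hx⟩))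
        rw [List.erase_cons_tail (by simpa using hex)]
        have := Finset.card_symmDiff_union_le (aq s e)
          (greedyQueries prom acc tq aq n (acc s e) t) (aq s e)
          (greedyQueries prom acc tq aq n (acc s e) (t.erase x))
        rw [symmDiff_self, Finset.bot_eq_empty, Finset.card_empty, zero_add] at this
        exact_mod_cast this
    refine (Finset.sum_le_sum key).trans (le_of_eq ?_)
    rw [Finset.sum_add_distrib, Finset.sum_const, Finset.sum_ite_eq' R x, if_pos hx, nsmul_eq_mul,
      add_mul, mul_comm b]
  · refine orderAvg_le fun l hl => ?_
    rw [List.erase_of_not_mem (by rwa [mem_of_mem_orderings hl])]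
    simp

/-- In a uniformly random order, adding or removing a fixed element changes few of the queries of
the greedy process, on average. -/
theorem orderAvg_greedyQueries_le {N n : ℕ} (hn : n ≤ N) (x : V) (s : σ) (hs : Inv s)
    (R : Finset V) (hx : x ∈ R) :
    orderAvg R (fun l => ((symmDiff (greedyQueries prom acc tq aq n s l)
        (greedyQueries prom acc tq aq n s (l.erase x))).card : ℝ≥0∞)) ≤
      ((2 * N * a + n * (4 * N + 2) : ℕ) : ℝ≥0∞) := by
  induction n generalizing s R with
  | zero => exact orderAvg_le fun l _ => by simp [greedyQueries]
  | succ n ih =>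
    -- The summand `2 * N * a`, present from round 0 on, is what the hypothesis `hb` of that lemma
    -- requires.
    have hhead := orderAvg_greedyHeadQueries_le prom acc tq aq hacc htq haq hn x
      ((2 * N * a + n * (4 * N + 2) : ℕ) : ℝ≥0∞) (by exact_mod_cast Nat.le_add_right _ _)
      (fun s hs R hx => ih (by omega) s hs R hx) s hs (R.filter fun y => prom s y = true)
    rw [← orderAvg_filter] at hhead
    -- The two lists face the same tests in this round except those of `x`, which are at most 2
    -- queries. Filtering commutes with erasing `x`.
    calc _ ≤ orderAvg R (fun l => 2 + ((symmDiff
            (greedyHeadQueries prom acc tq aq n s (l.filter fun y => prom s y = true))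
            (greedyHeadQueries prom acc tq aq n s
              ((l.filter fun y => prom s y = true).erase x))).card : ℝ≥0∞)) := by
          refine orderAvg_mono fun l hl => ?_
          have hnd := (mem_orderings.1 hl).1
          have hfil : (l.erase x).filter (prom s) = (l.filter (prom s)).erase x := by
            rw [hnd.erase_eq_filter, (hnd.filter _).erase_eq_filter, List.filter_filter,
              List.filter_filter]
            simp only [Bool.and_comm]
          have htests : (symmDiff (l.toFinset.biUnion (tq s))
              ((l.erase x).toFinset.biUnion (tq s))).card ≤ 2 := by
            refine (Finset.card_le_card fun q => ?_).trans (htq s x)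
            simp only [Finset.mem_symmDiff, Finset.mem_biUnion, List.mem_toFinset,
              hnd.mem_erase_iff]
            rintro (⟨⟨y, h1, h2⟩, h3⟩ | ⟨⟨y, h1, h2⟩, h3⟩)
            · by_contra hq
              exact h3 ⟨y, ⟨fun h => hq (h ▸ h2), h1⟩, h2⟩
            · exact absurd ⟨y, h1.2, h2⟩ h3
          simp only [greedyQueries_succ, hfil, Bool.decide_eq_true]
          have := (Finset.card_symmDiff_union_le (l.toFinset.biUnion (tq s))
            (greedyHeadQueries prom acc tq aq n s (l.filter (prom s)))
            ((l.erase x).toFinset.biUnion (tq s))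
            (greedyHeadQueries prom acc tq aq n s ((l.filter (prom s)).erase x))).trans
              (Nat.add_le_add_right htests _)
          exact_mod_cast this
      _ ≤ 2 + (((2 * N * a + n * (4 * N + 2) : ℕ) : ℝ≥0∞) + 4 * N) := by
          rw [orderAvg_add, orderAvg_const]
          gcongr
      _ = _ := by push_cast; ring

end Greedy

/-! ### The greedy swapping procedure -/

/-- The state of the swapping procedure: the current independent set, the weights of the accepted
elements, the set of all accepted elements, and its value. -/
structure SwapState (V : Type u) : Type u where
  sol : Finset V
  weight : V → ℝ
  accepted : Finset V
  value : ℝ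

/-- The state in which nothing has been accepted. -/
def SwapState.start {V : Type u} : SwapState V := ⟨∅, fun _ => 0, ∅, 0⟩

namespace SwapState

variable {V : Type u} [DecidableEq V]

/-- The elements of the current solution whose weight exceeds `c / 2`. -/
noncomputable def heavy (s : SwapState V) (c : ℝ) : Finset V :=
  s.sol.filter fun z => c < 2 * s.weight z

/-- Accept `e` with a weight of `v - s.value`, and replace the solution by `S`. -/
noncomputable def accept (s : SwapState V) (e : V) (v : ℝ) (S : Finset V) : SwapState V :=
  ⟨S, Function.update s.weight e (v - s.value), insert e s.accepted, v⟩

/-- Return `y` if its marginal value is at least `θ` and if it is not spanned by the elements of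
the solution of more than half that value. -/
noncomputable def test (θ : ℝ) (s : SwapState V) (y : V) : QueryTree V (Option V) :=
  .ask (.inl (insert y s.accepted)) fun v =>
    .ask (.inr (insert y (s.heavy (v - s.value)))) fun b =>
      .pure (if θ ≤ v - s.value ∧ b = 1 then some y else none)

/-- Return `z` if it can be exchanged for `e`. -/
noncomputable def exchange (s : SwapState V) (e z : V) : QueryTree V (Option V) :=
  .ask (.inr (insert e (s.sol.erase z))) fun b => .pure (if b = 1 then some z else none)

/-- Accept `e`, and exchange it for the element of least weight if the solution does not remain
independent. -/
noncomputable def step (s : SwapState V) (e : V) : QueryTree V (SwapState V) :=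
  .ask (.inl (insert e s.accepted)) fun v => .ask (.inr (insert e s.sol)) fun b =>
    if b = 1 then .pure (s.accept e v (insert e s.sol))
    else (QueryTree.filterMap (s.exchange e) s.sol.toList).bind fun L => .pure <|
      match L.argmin s.weight with
      -- A default: a promising element that makes the solution dependent always has an exchange
      -- (`Valid.next_eq`).
      | none => s
      | some d => s.accept e v (insert e (s.sol.erase d))

/-- Repeatedly discard the elements that fail the test and accept the first one that passes, for
at most `n` rounds. -/
noncomputable def process (θ : ℝ) : ℕ → SwapState V → List V → QueryTree V (SwapState V)
  | 0, s, _ => .pure s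
  | n + 1, s, l => (QueryTree.filterMap (s.test θ) l).bind fun L =>
      match L with
      | [] => .pure s
      | e :: t => (s.step e).bind fun s' => process θ n s' t

/-! ### Behaviour and query counts of the swapping procedure under the true oracles -/

variable (f : Finset V → ℝ) (M : Matroid V)

/-- The element `y` passes the test. -/
noncomputable def promising (θ : ℝ) (s : SwapState V) (y : V) : Bool :=
  ((s.test θ y).eval (oracleAnswer f M)).isSome

/-- The state after `e` has been accepted. -/
noncomputable def next (s : SwapState V) (e : V) : SwapState V :=
  (s.step e).eval (oracleAnswer f M)

omit [DecidableEq V] in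
theorem oracleAnswer_inr_eq_one {S : Finset V} :
    oracleAnswer f M (.inr S) = 1 ↔ M.Indep (S : Set V) := by
  simp [oracleAnswer]

theorem promising_iff {θ : ℝ} {s : SwapState V} {y : V} :
    s.promising f M θ y = true ↔ θ ≤ f (insert y s.accepted) - s.value ∧
      M.Indep (insert y (s.heavy (f (insert y s.accepted) - s.value)) : Finset V) := by
  rw [promising, test, QueryTree.eval_ask, QueryTree.eval_ask, QueryTree.eval_pure,
    ← oracleAnswer_inr_eq_one f M]
  change Option.isSome (if θ ≤ f (insert y s.accepted) - s.value ∧ oracleAnswer f M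
      (.inr (insert y (s.heavy (f (insert y s.accepted) - s.value)))) = 1
    then some y else none) = true ↔ _
  split_ifs with h <;> simp [h]

theorem eval_test (θ : ℝ) (s : SwapState V) (y : V) :
    (s.test θ y).eval (oracleAnswer f M) = if s.promising f M θ y then some y else none := by
  rw [promising, test, QueryTree.eval_ask, QueryTree.eval_ask, QueryTree.eval_pure]
  split_ifs <;> simp_all

theorem eval_filterMap_test (θ : ℝ) (s : SwapState V) (l : List V) :
    (QueryTree.filterMap (s.test θ) l).eval (oracleAnswer f M) =
      l.filter (s.promising f M θ) := by
  simp only [QueryTree.eval_filterMap, eval_test]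
  induction l with
  | nil => rfl
  | cons y l ih => by_cases h : s.promising f M θ y <;> simp [h, ih]

theorem queries_process (θ : ℝ) (n : ℕ) (s : SwapState V) (l : List V) :
    (process θ n s l).queries (oracleAnswer f M) =
      greedyQueries (promising f M θ) (next f M)
        (fun s y => (s.test θ y).queries (oracleAnswer f M))
        (fun s e => (s.step e).queries (oracleAnswer f M)) n s l := by
  induction n generalizing s l with
  | zero => rfl
  | succ n ih =>
    rw [process, greedyQueries, QueryTree.queries_bind, eval_filterMap_test]
    congr 1
    · ext q
      simp [QueryTree.mem_queries_filterMap]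
    · cases l.filter (s.promising f M θ) with
      | nil => rfl
      | cons e t => simp only [QueryTree.queries_bind, ih]; rfl

theorem eval_process_succ (θ : ℝ) (n : ℕ) (s : SwapState V) (l : List V) :
    (process θ (n + 1) s l).eval (oracleAnswer f M) =
      match l.filter (s.promising f M θ) with
      | [] => s
      | e :: t => (process θ n (s.next f M e) t).eval (oracleAnswer f M) := by
  rw [process, QueryTree.eval_bind, eval_filterMap_test]
  cases l.filter (s.promising f M θ) with
  | nil => rfl
  | cons e t => simp only [QueryTree.eval_bind]; rfl

theorem card_queries_test_le (θ : ℝ) (s : SwapState V) (y : V) :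
    ((s.test θ y).queries (oracleAnswer f M)).card ≤ 2 := by
  rw [test, QueryTree.queries_ask, QueryTree.queries_ask, QueryTree.queries_pure]
  exact Finset.card_insert_le _ _

theorem card_queries_step_le {k : ℕ} (s : SwapState V) (hs : s.sol.card ≤ k) (e : V) :
    ((s.step e).queries (oracleAnswer f M)).card ≤ k + 2 := by
  rw [step, QueryTree.queries_ask, QueryTree.queries_ask]
  refine (Finset.card_insert_le _ _).trans (Nat.succ_le_succ ((Finset.card_insert_le _ _).trans
    (Nat.succ_le_succ (le_trans ?_ hs))))
  split_ifs
  · simp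
  · rw [QueryTree.queries_bind, QueryTree.queries_pure, Finset.union_empty]
    refine (Finset.card_le_card (t := s.sol.image fun z => .inr (insert e (s.sol.erase z)))
      fun q hq => ?_).trans Finset.card_image_le
    obtain ⟨z, hz, hq⟩ := (QueryTree.mem_queries_filterMap _).1 hq
    rw [exchange, QueryTree.queries_ask, QueryTree.queries_pure, Finset.mem_insert] at hq
    exact Finset.mem_image.2 ⟨z, Finset.mem_toList.1 hz, by simpa [eq_comm] using hq⟩

/-- The elements that can be exchanged for `e`. -/
theorem mem_eval_exchange {s : SwapState V} {e d : V} :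
    d ∈ (QueryTree.filterMap (s.exchange e) s.sol.toList).eval (oracleAnswer f M) ↔
      d ∈ s.sol ∧ M.Indep (insert e (s.sol.erase d) : Finset V) := by
  rw [QueryTree.eval_filterMap, List.mem_filterMap]
  simp only [exchange, QueryTree.eval_ask, QueryTree.eval_pure, Finset.mem_toList]
  constructor
  · rintro ⟨z, hz, h⟩
    split_ifs at h with hi
    obtain rfl := Option.some_injective _ h
    exact ⟨hz, (oracleAnswer_inr_eq_one f M).1 hi⟩
  · rintro ⟨h1, h2⟩
    exact ⟨d, h1, if_pos ((oracleAnswer_inr_eq_one f M).2 h2)⟩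

theorem next_cases (s : SwapState V) (e : V) :
    (M.Indep (insert e s.sol : Finset V) ∧
      s.next f M e = s.accept e (f (insert e s.accepted)) (insert e s.sol)) ∨
    (¬ M.Indep (insert e s.sol : Finset V) ∧
      (((∀ d ∈ s.sol, ¬ M.Indep (insert e (s.sol.erase d) : Finset V)) ∧ s.next f M e = s) ∨
      ∃ d ∈ s.sol, M.Indep (insert e (s.sol.erase d) : Finset V) ∧
        (∀ z ∈ s.sol, M.Indep (insert e (s.sol.erase z) : Finset V) → s.weight d ≤ s.weight z) ∧
        s.next f M e = s.accept e (f (insert e s.accepted)) (insert e (s.sol.erase d)))) := by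
  have hstep : s.next f M e = (if oracleAnswer f M (.inr (insert e s.sol)) = 1
      then QueryTree.pure (s.accept e (f (insert e s.accepted)) (insert e s.sol))
      else (QueryTree.filterMap (s.exchange e) s.sol.toList).bind fun L => .pure <|
        match L.argmin s.weight with
        | none => s
        | some d => s.accept e (f (insert e s.accepted)) (insert e (s.sol.erase d))).eval
          (oracleAnswer f M) := rfl
  by_cases hi : M.Indep (insert e s.sol : Finset V)
  · rw [if_pos ((oracleAnswer_inr_eq_one f M).2 hi)] at hstep
    exact .inl ⟨hi, hstep⟩
  · refine .inr ⟨hi, ?_⟩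
    rw [if_neg (mt (oracleAnswer_inr_eq_one f M).1 hi), QueryTree.eval_bind, QueryTree.eval_pure] at hstep
    have hmem := fun d => mem_eval_exchange (d := d) (e := e) (s := s) f M
    generalize (QueryTree.filterMap (s.exchange e) s.sol.toList).eval (oracleAnswer f M) = L
      at hstep hmem
    cases hL : L.argmin s.weight with
    | none =>
      rw [hL] at hstep
      rw [List.argmin_eq_none] at hL
      subst hL
      exact .inl ⟨fun d hd h => by simpa using (hmem d).2 ⟨hd, h⟩, hstep⟩
    | some d =>
      rw [hL] at hstep
      obtain ⟨h1, h2⟩ := (hmem d).1 (List.argmin_mem hL)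
      exact .inr ⟨d, h1, h2, fun z hz h => List.le_of_mem_argmin ((hmem z).2 ⟨hz, h⟩) hL, hstep⟩

theorem indep_next {s : SwapState V} (hs : M.Indep (s.sol : Set V)) (e : V) :
    M.Indep ((s.next f M e).sol : Set V) := by
  rcases next_cases f M s e with ⟨h1, h2⟩ | ⟨-, ⟨-, h⟩ | ⟨d, -, h, -, h2⟩⟩
  · rw [h2]; exact h1
  · rwa [h]
  · rw [h2]; exact h

omit [DecidableEq V] in
theorem card_sol_le {k : ℕ} (hM : M.eRank = (k : ℕ∞)) {S : Finset V} (hS : M.Indep (S : Set V)) :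
    S.card ≤ k := by
  have := hS.encard_le_eRank
  rw [hM, Set.encard_coe_eq_coe_finsetCard] at this
  exact_mod_cast this

/-- In a uniformly random order, adding or removing a fixed element changes few of the queries of
the swapping procedure, on average. -/
theorem orderAvg_queries_process_le {k : ℕ} (hM : M.eRank = (k : ℕ∞)) (θ : ℝ) (N : ℕ) (x : V)
    (R : Finset V) (hx : x ∈ R) :
    orderAvg R (fun l => ((symmDiff ((process θ N .start l).queries (oracleAnswer f M))
        ((process θ N .start (l.erase x)).queries (oracleAnswer f M))).card : ℝ≥0∞)) ≤
      ((2 * N * (k + 2) + N * (4 * N + 2) : ℕ) : ℝ≥0∞) := by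
  simp only [queries_process]
  exact orderAvg_greedyQueries_le _ _ _ _ (Inv := fun s => M.Indep (s.sol : Set V))
    (fun s e hs => indep_next f M hs e) (fun s y => card_queries_test_le f M θ s y)
    (fun s e hs => card_queries_step_le f M s (card_sol_le M hM hs) e) le_rfl x _
    (by simp [start]) R hx

end SwapState

/-! ### Submodular functions and spanning sets -/

section Submodular

variable {V : Type u} [DecidableEq V] {f : Finset V → ℝ}

theorem IsMonotoneSetFun.le_insert (hf : IsMonotoneSetFun f) (X : Finset V) (e : V) :
    f X ≤ f (insert e X) := by
  have := hf X e
  rw [marginal, ← Finset.insert_eq] at this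
  linarith

theorem IsMonotoneSetFun.monotone (hf : IsMonotoneSetFun f) : Monotone f := by
  intro X Y h
  rw [← Finset.union_sdiff_of_subset h, Finset.union_comm]
  induction Y \ X using Finset.induction_on with
  | empty => simp
  | insert e Z _ ih =>
    rw [Finset.insert_union]
    exact ih.trans (hf.le_insert _ _)

theorem IsSubmodular.insert_sub_le (hs : IsSubmodular f) (hf : IsMonotoneSetFun f)
    {X Y : Finset V} (h : X ⊆ Y) (e : V) :
    f (insert e Y) - f Y ≤ f (insert e X) - f X := by
  by_cases he : e ∈ Y
  · rw [Finset.insert_eq_of_mem he, sub_self]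
    exact sub_nonneg.2 (hf.le_insert X e)
  · have := hs X Y h e he
    simpa only [marginal, ← Finset.insert_eq] using this

theorem IsSubmodular.union_le (hs : IsSubmodular f) (hf : IsMonotoneSetFun f)
    (A O : Finset V) : f (A ∪ O) ≤ f A + ∑ o ∈ O, (f (insert o A) - f A) := by
  induction O using Finset.induction_on with
  | empty => simp
  | insert e O he ih =>
    rw [Finset.sum_insert he, Finset.union_insert]
    have := hs.insert_sub_le hf (Finset.subset_union_left (s₁ := A) (s₂ := O)) e
    linarith

end Submodular

/-- If every element `o` of an independent set is spanned by the elements of `S` whose weight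
exceeds `g o`, then the total `g` is at most the total weight of `S`. -/
theorem Matroid.sum_le_sum_of_mem_closure {V : Type u} [DecidableEq V] (M : Matroid V)
    {O S : Finset V} {g w : V → ℝ} (hO : M.Indep (O : Set V)) (hw : ∀ z ∈ S, 0 ≤ w z)
    (h : ∀ o ∈ O, o ∈ M.closure (S.filter fun z => g o < w z : Finset V)) :
    ∑ o ∈ O, g o ≤ ∑ z ∈ S, w z := by
  -- Hall's condition: if `o` minimizes `g` on a subset `s` of `O`, all of `s` is spanned by the
  -- elements of `S` of weight above `g o`. These are therefore at least as many as the independent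
  -- set `s`, and all are admissible for `o`. The resulting matching `φ` satisfies `g o < w (φ o)`.
  obtain ⟨φ, hinj, hφ⟩ := (Finset.all_card_le_biUnion_card_iff_exists_injective
    (fun o : {o // o ∈ O} => S.filter fun z => g o < w z)).1 (by
      intro s
      rcases s.eq_empty_or_nonempty with rfl | hne
      · simp
      obtain ⟨o, ho, hmin⟩ := s.exists_min_image (fun o => g o) hne
      have hsub : ((s.map (Function.Embedding.subtype _) : Finset V) : Set V) ⊆
          M.closure (S.filter fun z => g o < w z : Finset V) := by
        intro y hy
        simp only [Finset.coe_map, Set.mem_image] at hy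
        obtain ⟨y', hy', rfl⟩ := hy
        refine M.closure_subset_closure ?_ (h y' y'.2)
        intro z hz
        simp only [Finset.coe_filter, Set.mem_ofPred_eq] at hz ⊢
        exact ⟨hz.1, (hmin y' hy').trans_lt hz.2⟩
      have hind : M.Indep ((s.map (Function.Embedding.subtype _) : Finset V) : Set V) :=
        hO.subset (by intro y hy; simp at hy; exact hy.1)
      have h1 := hind.encard_le_eRk_of_subset hsub
      rw [M.eRk_closure_eq] at h1
      have h2 := h1.trans (M.eRk_le_encard _)
      rw [Set.encard_coe_eq_coe_finsetCard, Set.encard_coe_eq_coe_finsetCard, Finset.card_map,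
        Nat.cast_le] at h2
      exact h2.trans (Finset.card_le_card
        (Finset.subset_biUnion_of_mem (fun o : {o // o ∈ O} => S.filter fun z => g o < w z) ho)))
  simp only [Finset.mem_filter] at hφ
  rw [← Finset.sum_attach]
  calc ∑ o ∈ O.attach, g o ≤ ∑ o ∈ O.attach, w (φ o) :=
        Finset.sum_le_sum fun o _ => (hφ o).2.le
    _ = ∑ z ∈ O.attach.image φ, w z := (Finset.sum_image fun a _ b _ h => hinj h).symm
    _ ≤ ∑ z ∈ S, w z := Finset.sum_le_sum_of_subset_of_nonneg
        (by intro z hz; obtain ⟨o, _, rfl⟩ := Finset.mem_image.1 hz; exact (hφ o).1)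
        fun z hz _ => hw z hz

/-! ### Correctness of the swapping procedure -/

namespace SwapState

variable {V : Type u} [DecidableEq V]

/-- The invariants of the swapping procedure when all accepted weights lie in `[θ, B]`. -/
structure Valid (f : Finset V → ℝ) (M : Matroid V) (θ B : ℝ) (s : SwapState V) : Prop where
  indep : M.Indep (s.sol : Set V)
  value_eq : s.value = f s.accepted
  sol_subset : s.sol ⊆ s.accepted
  value_le : s.value ≤ 2 * ∑ z ∈ s.sol, s.weight z
  sum_le : ∀ T ⊆ s.accepted, ∑ z ∈ T, s.weight z ≤ f T
  le_weight : ∀ z ∈ s.sol, θ ≤ s.weight z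
  weight_le : ∀ z ∈ s.sol, s.weight z ≤ B

/-- The marginal value of `y` is less than `θ`, or `y` is spanned by the elements of more than half
that value. -/
def Rejected (f : Finset V → ℝ) (M : Matroid V) (θ : ℝ) (s : SwapState V) (y : V) : Prop :=
  f (insert y s.accepted) - s.value < θ ∨
    y ∈ M.closure (s.heavy (f (insert y s.accepted) - s.value) : Finset V)

/-- A quantity that grows by at least one whenever an element is accepted. -/
noncomputable def potential (θ : ℝ) (s : SwapState V) : ℝ :=
  ∑ z ∈ s.sol, (1 + Real.logb 2 (s.weight z / θ))

variable {f : Finset V → ℝ} {M : Matroid V} {θ B : ℝ} {s : SwapState V} {e : V}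

omit [DecidableEq V] in
theorem mem_heavy {c : ℝ} {z : V} : z ∈ s.heavy c ↔ z ∈ s.sol ∧ c < 2 * s.weight z := by
  simp [heavy]

omit [DecidableEq V] in
theorem heavy_subset_sol (c : ℝ) : s.heavy c ⊆ s.sol := Finset.filter_subset _ _

omit [DecidableEq V] in
theorem valid_start (hf0 : f ∅ = 0) : (start : SwapState V).Valid f M θ B := by
  refine ⟨by simp [start], by simp [start, hf0], by simp [start], by simp [start], ?_,
    by simp [start], by simp [start]⟩
  intro T hT
  obtain rfl := Finset.subset_empty.1 hT
  simp [hf0]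

theorem Valid.notMem_accepted (hs : s.Valid f M θ B) (hθ : 0 < θ)
    (he : s.promising f M θ e = true) : e ∉ s.accepted := by
  intro h
  have := ((promising_iff f M).1 he).1
  rw [Finset.insert_eq_of_mem h, hs.value_eq, sub_self] at this
  linarith

/-- The elements exchangeable for `e` are those of its fundamental circuit in the solution. The test
says that `e` is independent of the heavy elements, so the circuit contains a light one, and the
least weight `d` of the circuit is light too. The last clause prepares the monotonicity of the spans
of heavy elements. -/
theorem Valid.next_eq (hs : s.Valid f M θ B) (hθ : 0 < θ)
    (he : s.promising f M θ e = true) :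
    ∃ T ⊆ s.sol, s.next f M e = s.accept e (f (insert e s.accepted)) (insert e T) ∧
      (T = s.sol ∨ ∃ d ∈ s.sol, T = s.sol.erase d ∧
        2 * s.weight d ≤ f (insert e s.accepted) - s.value ∧
        ∀ c, (s.heavy c : Set V) ⊆ M.closure (insert e ((s.heavy c).erase d) : Finset V) ∨
          d ∉ s.heavy c) := by
  have heA := hs.notMem_accepted hθ he
  have heS : e ∉ s.sol := fun h => heA (hs.sol_subset h)
  obtain ⟨hm, hH⟩ := (promising_iff f M).1 he
  set m := f (insert e s.accepted) - s.value with hmdef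
  have heE : e ∈ M.E := hH.subset_ground (by simp)
  rcases next_cases f M s e with ⟨h1, h2⟩ | ⟨h1, h⟩
  · exact ⟨s.sol, subset_rfl, h2, .inl rfl⟩
  have hcl : e ∈ M.closure (s.sol : Set V) := by
    by_contra hc
    rw [hs.indep.notMem_closure_iff] at hc
    exact h1 (by simpa using hc.1)
  have hmem : ∀ z ∈ s.sol, (z ∈ M.fundCircuit e s.sol ↔
      M.Indep (insert e (s.sol.erase z) : Finset V)) := by
    intro z hz
    rw [hs.indep.mem_fundCircuit_iff hcl heS, Finset.coe_insert, Finset.coe_erase,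
      Set.insert_sdiff_singleton_comm]
    rintro rfl; exact heS hz
  have hC := hs.indep.fundCircuit_isCircuit hcl heS
  have hCsub := M.fundCircuit_subset_insert e (s.sol : Set V)
  obtain ⟨z, hzC, hzH⟩ : ∃ z ∈ M.fundCircuit e s.sol, z ∉ (insert e (s.heavy m) : Finset V) := by
    by_contra! hall
    exact hC.dep.not_indep (hH.subset hall)
  have hze : z ≠ e := by rintro rfl; simp at hzH
  have hzS : z ∈ s.sol := (hCsub hzC).resolve_left hze
  have hzw : 2 * s.weight z ≤ m := by
    by_contra! hlt
    exact hzH (Finset.mem_insert_of_mem (mem_heavy.2 ⟨hzS, hlt⟩))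
  rcases h with ⟨h, -⟩ | ⟨d, hd, hdi, hmin, hnext⟩
  · exact absurd ((hmem z hzS).1 hzC) (h z hzS)
  have hzmin := hmin z hzS ((hmem z hzS).1 hzC)
  refine ⟨s.sol.erase d, Finset.erase_subset _ _, hnext, .inr ⟨d, hd, rfl, by linarith, ?_⟩⟩
  intro c
  by_cases hdc : d ∈ s.heavy c
  swap
  · exact .inr hdc
  left
  -- Since `d` is lightest on the circuit, once `d` is heavy so is every other circuit element
  -- except possibly `e`; they then span `d`.
  have hsub : M.fundCircuit e s.sol \ {d} ⊆ (insert e ((s.heavy c).erase d) : Finset V) := by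
    rintro y ⟨hy, hyd⟩
    rcases hCsub hy with rfl | hyS
    · simp
    · have hyS : y ∈ s.sol := hyS
      refine Finset.mem_coe.2 (Finset.mem_insert_of_mem (Finset.mem_erase.2 ⟨hyd, mem_heavy.2 ⟨hyS, ?_⟩⟩))
      have := hmin y hyS ((hmem y hyS).1 hy)
      have := (mem_heavy.1 hdc).2
      linarith
  have hground : ((insert e ((s.heavy c).erase d) : Finset V) : Set V) ⊆ M.E := by
    rw [Finset.coe_insert]
    refine Set.insert_subset heE (subset_trans ?_ hs.indep.subset_ground)
    exact Finset.coe_subset.2 ((Finset.erase_subset _ _).trans (heavy_subset_sol c))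
  intro y hy
  by_cases hyd : y = d
  · subst hyd
    exact M.closure_subset_closure hsub
      (hC.mem_closure_sdiff_singleton_of_mem ((hmem y hd).2 hdi))
  · exact M.subset_closure _ hground (Finset.mem_coe.2
      (Finset.mem_insert_of_mem (Finset.mem_erase.2 ⟨hyd, hy⟩)))

/-- Losing a heavy `d` does no harm: `e` and the remaining heavy elements span it, and `e` is itself
heavy, having at least twice the weight of `d`. -/
theorem Valid.closure_heavy_subset (hs : s.Valid f M θ B) (hθ : 0 < θ)
    (he : s.promising f M θ e = true) (c : ℝ) :
    M.closure (s.heavy c : Set V) ⊆ M.closure ((s.next f M e).heavy c : Set V) := by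
  have heA := hs.notMem_accepted hθ he
  have heS : e ∉ s.sol := fun h => heA (hs.sol_subset h)
  obtain ⟨T, hT, hnext, h⟩ := hs.next_eq hθ he
  have hw : ∀ z ∈ s.sol, (s.next f M e).weight z = s.weight z := by
    intro z hz
    rw [hnext]
    exact Function.update_of_ne (by rintro rfl; exact heS hz) _ _
  have hsol : (s.next f M e).sol = insert e T := by rw [hnext]; rfl
  have hkeep : ∀ z ∈ T, z ∈ s.heavy c → z ∈ (s.next f M e).heavy c := by
    intro z hz hzc
    rw [mem_heavy, hsol, hw z (hT hz)]
    exact ⟨Finset.mem_insert_of_mem hz, (mem_heavy.1 hzc).2⟩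
  rcases h with rfl | ⟨d, hd, rfl, hdw, hcl⟩
  · exact M.closure_subset_closure fun z hz => hkeep z (heavy_subset_sol c hz) hz
  by_cases hdc : d ∈ s.heavy c
  · refine M.closure_subset_closure_of_subset_closure
      (((hcl c).resolve_right (not_not.2 hdc)).trans (M.closure_subset_closure ?_))
    intro z hz
    rcases Finset.mem_insert.1 (Finset.mem_coe.1 hz) with rfl | hz
    · refine mem_heavy.2 ⟨by rw [hsol]; simp, ?_⟩
      have h1 := (mem_heavy.1 hdc).2
      -- Positivity of the weight of `d` gives `2 w(d) ≥ w(d)`, whence `c < 2 w(d) ≤ w(e) ≤ 2 w(e)`.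
      have h2 := hs.le_weight d hd
      have h3 : (s.next f M z).weight z = f (insert z s.accepted) - s.value := by
        rw [hnext]; simp [accept]
      rw [h3]
      linarith
    · obtain ⟨hzd, hz⟩ := Finset.mem_erase.1 hz
      exact hkeep z (Finset.mem_erase.2 ⟨hzd, heavy_subset_sol c hz⟩) hz
  · refine M.closure_subset_closure fun z hz => hkeep z (Finset.mem_erase.2 ⟨?_, heavy_subset_sol c hz⟩) hz
    rintro rfl; exact hdc hz

/-- The value grows by the marginal value `m` of `e`, while the total weight grows by `m` or by `m -
w(d) ≥ m / 2`, which preserves `value_le`. Submodularity preserves `sum_le`, as `m` is at most the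
marginal value over any subset of the accepted set. For the potential, an insertion adds a term at
least 1, and an exchange at least doubles a weight and so raises its logarithm by at least 1. -/
theorem Valid.next (hs : s.Valid f M θ B) (hmono : IsMonotoneSetFun f) (hsub : IsSubmodular f)
    (hf0 : f ∅ = 0) (hθ : 0 < θ) (he : s.promising f M θ e = true) (heB : f {e} ≤ B) :
    (s.next f M e).Valid f M θ B ∧ (s.next f M e).accepted = insert e s.accepted ∧
      s.potential θ + 1 ≤ (s.next f M e).potential θ := by
  have heA := hs.notMem_accepted hθ he
  have heS : e ∉ s.sol := fun h => heA (hs.sol_subset h)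
  have hm := ((promising_iff f M).1 he).1
  have hmB : f (insert e s.accepted) - s.value ≤ B := by
    have := hsub.insert_sub_le hmono (Finset.empty_subset s.accepted) e
    rw [hf0, sub_zero, ← hs.value_eq] at this
    exact this.trans heB
  have hind := indep_next f M hs.indep e
  obtain ⟨T, hT, hnext, h⟩ := hs.next_eq hθ he
  have heT : e ∉ T := fun h => heS (hT h)
  have hw : ∀ z ∈ s.accepted, (s.next f M e).weight z = s.weight z := by
    intro z hz
    rw [hnext]
    exact Function.update_of_ne (by rintro rfl; exact heA hz) _ _
  have hwe : (s.next f M e).weight e = f (insert e s.accepted) - s.value := by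
    rw [hnext]; simp [accept]
  have hsol : (s.next f M e).sol = insert e T := by rw [hnext]; rfl
  have hacc : (s.next f M e).accepted = insert e s.accepted := by rw [hnext]; rfl
  have hval : (s.next f M e).value = f (insert e s.accepted) := by rw [hnext]; rfl
  have hwT : ∀ g : ℝ → ℝ, ∑ z ∈ insert e T, g ((s.next f M e).weight z) =
      g (f (insert e s.accepted) - s.value) + ∑ z ∈ T, g (s.weight z) := by
    intro g
    rw [Finset.sum_insert heT, hwe]
    congr 1
    exact Finset.sum_congr rfl fun z hz => by rw [hw z (hs.sol_subset (hT hz))]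
  have hlogm : 0 ≤ Real.logb 2 ((f (insert e s.accepted) - s.value) / θ) :=
    Real.logb_nonneg (by norm_num) ((one_le_div hθ).2 hm)
  refine ⟨⟨hind, ?_, ?_, ?_, ?_, ?_, ?_⟩, hacc, ?_⟩
  · rw [hval, hacc]
  · rw [hsol, hacc]
    exact Finset.insert_subset_insert _ (hT.trans hs.sol_subset)
  · rw [hval, hsol, hwT fun x => x]
    have h1 := hs.value_le
    rcases h with rfl | ⟨d, hd, rfl, hdw, -⟩
    · linarith
    · have := Finset.add_sum_erase s.sol s.weight hd
      linarith
  · intro X hX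
    rw [hacc] at hX
    by_cases heX : e ∈ X
    · have hX' : X.erase e ⊆ s.accepted := by
        intro z hz
        obtain ⟨h1, h2⟩ := Finset.mem_erase.1 hz
        exact (Finset.mem_insert.1 (hX h2)).resolve_left h1
      have h1 := hs.sum_le _ hX'
      have h2 := hsub.insert_sub_le hmono hX' e
      rw [Finset.insert_erase heX, ← hs.value_eq] at h2
      rw [← Finset.add_sum_erase X _ heX, hwe,
        Finset.sum_congr rfl fun z hz => hw z (hX' hz)]
      linarith
    · have hX' : X ⊆ s.accepted := fun z hz =>
        (Finset.mem_insert.1 (hX hz)).resolve_left (by rintro rfl; exact heX hz)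
      rw [Finset.sum_congr rfl fun z hz => hw z (hX' hz)]
      exact hs.sum_le _ hX'
  · intro z hz
    rw [hsol] at hz
    rcases Finset.mem_insert.1 hz with rfl | hz
    · rwa [hwe]
    · rw [hw z (hs.sol_subset (hT hz))]
      exact hs.le_weight z (hT hz)
  · intro z hz
    rw [hsol] at hz
    rcases Finset.mem_insert.1 hz with rfl | hz
    · rwa [hwe]
    · rw [hw z (hs.sol_subset (hT hz))]
      exact hs.weight_le z (hT hz)
  · rw [potential, potential, hsol, hwT fun x => 1 + Real.logb 2 (x / θ)]
    rcases h with rfl | ⟨d, hd, rfl, hdw, -⟩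
    · linarith
    · have h1 := Finset.add_sum_erase s.sol (fun z => 1 + Real.logb 2 (s.weight z / θ)) hd
      have hd0 : 0 < s.weight d / θ := div_pos (hθ.trans_le (hs.le_weight d hd)) hθ
      have h2 : 1 + Real.logb 2 (s.weight d / θ) ≤
          Real.logb 2 ((f (insert e s.accepted) - s.value) / θ) := by
        rw [← Real.logb_self_eq_one (b := 2) (by norm_num),
          ← Real.logb_mul (by norm_num) hd0.ne']
        refine Real.logb_le_logb_of_le (by norm_num) (by positivity) ?_
        rw [← mul_div_assoc]
        exact div_le_div_of_nonneg_right hdw hθ.le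
      linarith

/-- Marginal values only decrease, which keeps them below `θ` and lets more elements count as heavy;
the spans of heavy elements only grow. This justifies discarding an element for good after one
failed test. -/
theorem Valid.rejected_next (hs : s.Valid f M θ B) (hmono : IsMonotoneSetFun f)
    (hsub : IsSubmodular f) (hf0 : f ∅ = 0) (hθ : 0 < θ) (he : s.promising f M θ e = true)
    (heB : f {e} ≤ B) {y : V} (hy : s.Rejected f M θ y) :
    (s.next f M e).Rejected f M θ y := by
  obtain ⟨hv, hacc, -⟩ := hs.next hmono hsub hf0 hθ he heB
  have hle : f (insert y (s.next f M e).accepted) - (s.next f M e).value ≤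
      f (insert y s.accepted) - s.value := by
    rw [hv.value_eq, hs.value_eq, hacc]
    exact hsub.insert_sub_le hmono (Finset.subset_insert _ _) y
  rcases hy with hy | hy
  · exact .inl (hle.trans_lt hy)
  · refine .inr (hs.closure_heavy_subset hθ he _ (M.closure_subset_closure ?_ hy))
    intro z hz
    obtain ⟨h1, h2⟩ := mem_heavy.1 (Finset.mem_coe.1 hz)
    exact Finset.mem_coe.2 (mem_heavy.2 ⟨h1, hle.trans_lt h2⟩)

theorem Valid.rejected_of_not_promising (hs : s.Valid f M θ B) {y : V}
    (hyM : M.Indep {y}) (hy : s.promising f M θ y ≠ true) : s.Rejected f M θ y := by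
  rw [Ne, promising_iff, not_and_or, not_le] at hy
  refine hy.imp_right fun h => ?_
  have hyE : y ∈ M.E := hyM.subset_ground rfl
  by_contra hc
  rw [(hs.indep.subset (Finset.coe_subset.2 (heavy_subset_sol _))).notMem_closure_iff] at hc
  exact h (by simpa using hc.1)

omit [DecidableEq V] in
theorem Valid.potential_le (hs : s.Valid f M θ B) (hθ : 0 < θ) {k h : ℕ}
    (hM : M.eRank = (k : ℕ∞)) (hB : B ≤ 2 ^ h * θ) : s.potential θ ≤ k * (h + 1) := by
  have h1 : ∀ z ∈ s.sol, 1 + Real.logb 2 (s.weight z / θ) ≤ h + 1 := by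
    intro z hz
    have hpos : 0 < s.weight z / θ := div_pos (hθ.trans_le (hs.le_weight z hz)) hθ
    have : Real.logb 2 (s.weight z / θ) ≤ h := by
      rw [Real.logb_le_iff_le_rpow (by norm_num) hpos, Real.rpow_natCast, div_le_iff₀ hθ]
      exact (hs.weight_le z hz).trans hB
    linarith
  refine (Finset.sum_le_card_nsmul _ _ _ h1).trans ?_
  rw [nsmul_eq_mul]
  gcongr
  exact_mod_cast card_sol_le M hM hs.indep

/-- The hypothesis `hn` says that the remaining rounds suffice to lift the potential to its maximum.
The procedure thus never stops for lack of rounds while a promising element is left, and every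
listed element ends up accepted or rejected. -/
theorem Valid.eval_process (hmono : IsMonotoneSetFun f) (hsub : IsSubmodular f) (hf0 : f ∅ = 0)
    (hθ : 0 < θ) {k h : ℕ} (hM : M.eRank = (k : ℕ∞)) (hB : B ≤ 2 ^ h * θ) (n : ℕ)
    (s : SwapState V) (hs : s.Valid f M θ B) (hn : (k * (h + 1) : ℝ) ≤ s.potential θ + n)
    (l : List V) (hl : ∀ y ∈ l, M.Indep {y} ∧ f {y} ≤ B) :
    ((process θ n s l).eval (oracleAnswer f M)).Valid f M θ B ∧
    s.accepted ⊆ ((process θ n s l).eval (oracleAnswer f M)).accepted ∧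
    ((process θ n s l).eval (oracleAnswer f M)).accepted ⊆ s.accepted ∪ l.toFinset ∧
    (∀ y, s.Rejected f M θ y →
      ((process θ n s l).eval (oracleAnswer f M)).Rejected f M θ y) ∧
    ∀ y ∈ l, y ∈ ((process θ n s l).eval (oracleAnswer f M)).accepted ∨
      ((process θ n s l).eval (oracleAnswer f M)).Rejected f M θ y := by
  induction n generalizing s l with
  | zero =>
    refine ⟨hs, subset_rfl, Finset.subset_union_left, fun y h => h, fun y hy => .inr ?_⟩
    -- With no round left the potential is at its maximum; accepting one more element would exceed
    -- it.
    refine hs.rejected_of_not_promising (hl y hy).1 fun hp => ?_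
    obtain ⟨h1, -, h2⟩ := hs.next hmono hsub hf0 hθ hp (hl y hy).2
    have := h1.potential_le hθ hM hB
    simp only [Nat.cast_zero, add_zero] at hn
    linarith
  | succ n ih =>
    rw [eval_process_succ]
    cases hL : l.filter (s.promising f M θ) with
    | nil =>
      refine ⟨hs, subset_rfl, Finset.subset_union_left, fun y h => h, fun y hy => .inr ?_⟩
      exact hs.rejected_of_not_promising (hl y hy).1 (List.filter_eq_nil_iff.1 hL y hy)
    | cons e t =>
      have hmemL : ∀ y, y ∈ e :: t ↔ y ∈ l ∧ s.promising f M θ y = true := fun y => by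
        rw [← hL, List.mem_filter]
      obtain ⟨hel, hep⟩ := (hmemL e).1 (by simp)
      obtain ⟨h1, h2, h3⟩ := hs.next hmono hsub hf0 hθ hep (hl e hel).2
      have hpersist := fun y => hs.rejected_next hmono hsub hf0 hθ hep (hl e hel).2 (y := y)
      obtain ⟨i1, i2, i3, i4, i5⟩ := ih (s.next f M e) h1 (by push_cast at hn; linarith) t
        fun y hy => hl y ((hmemL y).1 (List.mem_cons_of_mem _ hy)).1
      rw [h2] at i2 i3
      refine ⟨i1, (Finset.subset_insert _ _).trans i2, i3.trans ?_,
        fun y hy => i4 y (hpersist y hy), fun y hy => ?_⟩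
      · intro y hy
        simp only [Finset.mem_union, Finset.mem_insert, List.mem_toFinset] at hy ⊢
        rcases hy with (rfl | hy) | hy
        · exact .inr hel
        · exact .inl hy
        · exact .inr ((hmemL y).1 (List.mem_cons_of_mem _ hy)).1
      · by_cases hp : s.promising f M θ y = true
        · rcases List.mem_cons.1 ((hmemL y).2 ⟨hy, hp⟩) with rfl | hyt
          · exact .inl (i2 (Finset.mem_insert_self _ _))
          · exact i5 y hyt
        · exact .inr (i4 y (hpersist y (hs.rejected_of_not_promising (hl y hy).1 hp)))

/-- The value of an independent set all of whose elements were accepted, rejected, or have small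
value. -/
theorem Valid.le_of_rejected (hs : s.Valid f M θ B) (hmono : IsMonotoneSetFun f)
    (hsub : IsSubmodular f) (hf0 : f ∅ = 0) (hθ : 0 < θ) {k : ℕ} (hM : M.eRank = (k : ℕ∞))
    {O : Finset V} (hO : M.Indep (O : Set V))
    (h : ∀ o ∈ O, o ∈ s.accepted ∨ s.Rejected f M θ o ∨ f {o} ≤ θ) :
    f O ≤ 4 * f s.sol + k * θ := by
  have h1 : f O ≤ f s.accepted + ∑ o ∈ O, (f (insert o s.accepted) - f s.accepted) :=
    (hmono.monotone Finset.subset_union_right).trans (hsub.union_le hmono s.accepted O)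
  set g : V → ℝ := fun o => f (insert o s.accepted) - f s.accepted with hg
  have hg0 : ∀ o, 0 ≤ g o := fun o => sub_nonneg.2 (hmono.le_insert _ o)
  classical
  -- The elements of `P` are charged to the doubled weights of the solution, hence to `2 f(sol)`;
  -- the other `2 f(sol)` bounds the value of the accepted set. Outside `P` every marginal value is
  -- at most `θ`.
  set P := O.filter fun o => o ∈ M.closure (s.heavy (g o) : Finset V) with hP
  have h2 : ∑ o ∈ P, g o ≤ ∑ z ∈ s.sol, 2 * s.weight z := by
    refine M.sum_le_sum_of_mem_closure
      (hO.subset (Finset.coe_subset.2 (Finset.filter_subset _ _))) ?_ ?_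
    · intro z hz
      have := hs.le_weight z hz
      linarith
    · intro o ho
      exact (Finset.mem_filter.1 ho).2
  have h3 : ∀ o ∈ O \ P, g o ≤ θ := by
    intro o ho
    obtain ⟨hoO, hoP⟩ := Finset.mem_sdiff.1 ho
    rcases h o hoO with h | h | h
    · simp only [hg, Finset.insert_eq_of_mem h, sub_self]; exact hθ.le
    · rw [Rejected, hs.value_eq] at h
      rcases h with h | h
      · exact h.le
      · exact (hoP (Finset.mem_filter.2 ⟨hoO, h⟩)).elim
    · have := hsub.insert_sub_le hmono (Finset.empty_subset s.accepted) o
      rw [hf0, sub_zero] at this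
      exact this.trans h
  have h4 : ∑ o ∈ O \ P, g o ≤ k * θ := by
    refine (Finset.sum_le_card_nsmul _ _ _ h3).trans ?_
    rw [nsmul_eq_mul]
    gcongr
    exact (Finset.card_le_card Finset.sdiff_subset).trans (card_sol_le M hM hO)
  have h5 := Finset.sum_sdiff (f := g) (Finset.filter_subset _ _ : P ⊆ O)
  have h6 := hs.value_le
  have h7 := hs.sum_le _ hs.sol_subset
  rw [← Finset.mul_sum] at h2
  rw [hs.value_eq] at h6
  linarith

end SwapState

/-! ### The static algorithm -/

namespace SwapState

variable {V : Type u} [DecidableEq V]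

/-- Return `x` with the scale of its value, if `x` is independent and of positive value. -/
noncomputable def classify (x : V) : QueryTree V (Option (V × ℤ)) :=
  .ask (.inl {x}) fun v => .ask (.inr {x}) fun b =>
    .pure (if 0 < v ∧ b = 1 then some (x, Int.clog 2 v) else none)

/-- The elements whose scale is in `[j - h, j]`. -/
def scaleMembers (h : ℕ) (L : List (V × ℤ)) (j : ℤ) : List V :=
  (L.filter fun z => z.2 ≤ j ∧ j ≤ z.2 + h).map Prod.fst

/-- The swapping procedure on the elements whose scale is in `[j - h, j]`. -/
noncomputable def processScale (h N : ℕ) (j : ℤ) (l : List V) : QueryTree V (SwapState V) :=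
  -- Elements of scale at most `j` have value at most `2 ^ j`, which is `2 ^ h` times this
  -- threshold.
  process ((2 : ℝ) ^ (j - h)) N start l

/-- Run the swapping procedure at all scales, and return the solution of the highest scale that is
the scale of an element. -/
noncomputable def solve (h N : ℕ) (l : List V) : QueryTree V (Finset V) :=
  (QueryTree.filterMap classify l).bind fun L =>
    match L.argmax Prod.snd with
    | none => .pure ∅
    -- The results of these runs are discarded; only their queries matter. They are asked at every
    -- scale so that a change of the highest scale brings no queries beyond those caused by the
    -- changed lists.
    | some z => QueryTree.forEach (fun j => processScale h N j (scaleMembers h L j))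
        ((processScale h N z.2 (scaleMembers h L z.2)).bind fun s => .pure s.sol)
        (L.toFinset.biUnion fun z => Finset.Icc z.2 (z.2 + h)).toList

/-! ### Queries of the static algorithm and their stability -/

variable (f : Finset V → ℝ) (M : Matroid V)

open Classical in
/-- Whether `x` takes part in the procedure at scale `j`. -/
noncomputable def inScale (h : ℕ) (j : ℤ) (x : V) : Bool :=
  decide ((0 < f {x} ∧ M.Indep {x}) ∧ Int.clog 2 (f {x}) ≤ j ∧ j ≤ Int.clog 2 (f {x}) + h)

omit [DecidableEq V] in
theorem inScale_iff {h : ℕ} {j : ℤ} {x : V} : inScale f M h j x = true ↔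
    (0 < f {x} ∧ M.Indep {x}) ∧ Int.clog 2 (f {x}) ≤ j ∧ j ≤ Int.clog 2 (f {x}) + h := by
  simp [inScale]

open Classical in
omit [DecidableEq V] in
theorem eval_classify (x : V) : (classify x).eval (oracleAnswer f M) =
    if 0 < f {x} ∧ M.Indep {x} then some (x, Int.clog 2 (f {x})) else none := by
  have h := oracleAnswer_inr_eq_one f M (S := {x})
  rw [Finset.coe_singleton] at h
  rw [classify, QueryTree.eval_ask, QueryTree.eval_ask, QueryTree.eval_pure]
  change (if 0 < f {x} ∧ oracleAnswer f M (.inr {x}) = 1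
    then some (x, Int.clog 2 (f {x})) else none) = _
  by_cases h1 : 0 < f {x} <;> by_cases h2 : M.Indep {x} <;> simp [h, h1, h2]

omit [DecidableEq V] in
theorem mem_eval_filterMap_classify {l : List V} {z : V × ℤ} :
    z ∈ (QueryTree.filterMap classify l).eval (oracleAnswer f M) ↔
      z.1 ∈ l ∧ (0 < f {z.1} ∧ M.Indep {z.1}) ∧ z.2 = Int.clog 2 (f {z.1}) := by
  classical
  rw [QueryTree.eval_filterMap, List.mem_filterMap]
  simp only [eval_classify]
  constructor
  · rintro ⟨x, hx, h⟩
    split_ifs at h with hi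
    obtain rfl := Option.some_injective _ h
    exact ⟨hx, hi, rfl⟩
  · rintro ⟨h1, h2, h3⟩
    exact ⟨z.1, h1, by rw [if_pos h2, ← h3]⟩

omit [DecidableEq V] in
theorem scaleMembers_eval (h : ℕ) (l : List V) (j : ℤ) :
    scaleMembers h ((QueryTree.filterMap classify l).eval (oracleAnswer f M)) j =
      l.filter (inScale f M h j) := by
  classical
  rw [QueryTree.eval_filterMap, scaleMembers]
  simp only [eval_classify]
  induction l with
  | nil => rfl
  | cons x l ih =>
    by_cases h1 : 0 < f {x} ∧ M.Indep {x}
    · simp only [List.filterMap_cons, if_pos h1]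
      by_cases h2 : Int.clog 2 (f {x}) ≤ j ∧ j ≤ Int.clog 2 (f {x}) + h
      · rw [List.filter_cons_of_pos (by simpa using h2),
          List.filter_cons_of_pos ((inScale_iff f M).2 ⟨h1, h2⟩), List.map_cons, ih]
      · rw [List.filter_cons_of_neg (by simpa using h2),
          List.filter_cons_of_neg (fun h => h2 ((inScale_iff f M).1 h).2), ih]
    · simp only [List.filterMap_cons, if_neg h1]
      rw [List.filter_cons_of_neg (fun h => h1 ((inScale_iff f M).1 h).1), ih]

theorem mem_queries_classify {x : V} {q : OracleQuery V} :
    q ∈ (classify x).queries (oracleAnswer f M) ↔ q = .inl {x} ∨ q = .inr {x} := by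
  simp [classify]

theorem queries_processScale_nil (h N : ℕ) (j : ℤ) :
    (processScale h N j ([] : List V)).queries (oracleAnswer f M) = ∅ := by
  rw [processScale, queries_process, greedyQueries_nil]

/-- The highest scale has disappeared from this description, so the effect of an update can be
studied scale by scale. All integers `j` may be allowed because a scale without elements asks
nothing. -/
theorem mem_queries_solve {h N : ℕ} {l : List V} {q : OracleQuery V} :
    q ∈ (solve h N l).queries (oracleAnswer f M) ↔
      (∃ x ∈ l, q = .inl {x} ∨ q = .inr {x}) ∨
      ∃ j, q ∈ (processScale h N j (l.filter (inScale f M h j))).queries (oracleAnswer f M) := by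
  rw [solve, QueryTree.queries_bind, Finset.mem_union, QueryTree.mem_queries_filterMap]
  simp only [mem_queries_classify]
  refine or_congr_right ?_
  have hmem := fun z => mem_eval_filterMap_classify f M (l := l) (z := z)
  have hsc := fun j => scaleMembers_eval f M h l j
  generalize (QueryTree.filterMap classify l).eval (oracleAnswer f M) = L at hmem hsc
  constructor
  · cases hL : L.argmax Prod.snd with
    | none => simp
    | some z =>
      simp only [QueryTree.mem_queries_forEach, QueryTree.queries_bind, QueryTree.queries_pure,
        Finset.union_empty, hsc]
      rintro (⟨j, -, hq⟩ | hq)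
      · exact ⟨j, hq⟩
      · exact ⟨_, hq⟩
  · rintro ⟨j, hq⟩
    obtain ⟨x, hx⟩ : ∃ x, x ∈ l.filter (inScale f M h j) := by
      refine List.exists_mem_of_ne_nil _ fun hnil => ?_
      rw [hnil, queries_processScale_nil] at hq
      simp at hq
    obtain ⟨hxl, hx⟩ := List.mem_filter.1 hx
    obtain ⟨h1, h2⟩ := (inScale_iff f M).1 hx
    have hxL := (hmem (x, Int.clog 2 (f {x}))).2 ⟨hxl, h1, rfl⟩
    cases hL : L.argmax Prod.snd with
    | none =>
      rw [List.argmax_eq_none] at hL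
      subst hL
      simp at hxL
    | some z =>
      simp only [QueryTree.mem_queries_forEach, hsc]
      refine .inl ⟨j, ?_, hq⟩
      rw [Finset.mem_toList, Finset.mem_biUnion]
      exact ⟨_, List.mem_toFinset.2 hxL, Finset.mem_Icc.2 h2⟩

/-- The bound on the expected number of new queries after an update. -/
def updateBound (k h N : ℕ) : ℕ :=
  2 + (h + 1) * (2 * N * (k + 2) + N * (4 * N + 2))

/-- In a uniformly random order, adding or removing a fixed element changes few of the queries of
the static algorithm, on average. -/
theorem orderAvg_queries_solve_le {k : ℕ} (hM : M.eRank = (k : ℕ∞)) (h N : ℕ) (x : V)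
    (A : Finset V) :
    orderAvg A (fun l => ((symmDiff ((solve h N l).queries (oracleAnswer f M))
        ((solve h N (l.erase x)).queries (oracleAnswer f M))).card : ℝ≥0∞)) ≤
      (updateBound k h N : ℝ≥0∞) := by
  -- Only at these `h + 1` scales can `x` be a member; at the others the list, hence the query set,
  -- does not change.
  set J := Finset.Icc (Int.clog 2 (f {x})) (Int.clog 2 (f {x}) + h) with hJ
  set D : ℤ → List V → Finset (OracleQuery V) := fun j l =>
    symmDiff ((processScale h N j l).queries (oracleAnswer f M))
      ((processScale h N j (l.erase x)).queries (oracleAnswer f M)) with hD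
  have hpt : ∀ l ∈ orderings A, ((symmDiff ((solve h N l).queries (oracleAnswer f M))
        ((solve h N (l.erase x)).queries (oracleAnswer f M))).card : ℝ≥0∞) ≤
      2 + ∑ j ∈ J, ((D j (l.filter fun y => inScale f M h j y = true)).card : ℝ≥0∞) := by
    intro l hl
    have hnd := (mem_orderings.1 hl).1
    have hfil : ∀ j, (l.erase x).filter (inScale f M h j) =
        (l.filter (inScale f M h j)).erase x := by
      intro j
      rw [hnd.erase_eq_filter, (hnd.filter _).erase_eq_filter, List.filter_filter,
        List.filter_filter]
      simp only [Bool.and_comm]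
    have hsub : symmDiff ((solve h N l).queries (oracleAnswer f M))
        ((solve h N (l.erase x)).queries (oracleAnswer f M)) ⊆
        {.inl {x}, .inr {x}} ∪ J.biUnion fun j => D j (l.filter (inScale f M h j)) := by
      have hout : ∀ j, j ∉ J → (l.filter (inScale f M h j)).erase x =
          l.filter (inScale f M h j) := by
        intro j hj
        refine List.erase_of_not_mem fun hx => hj ?_
        exact Finset.mem_Icc.2 ((inScale_iff f M).1 (List.mem_filter.1 hx).2).2
      have hin : ∀ q j, q ∈ symmDiff
          ((processScale h N j (l.filter (inScale f M h j))).queries (oracleAnswer f M))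
          ((processScale h N j ((l.filter (inScale f M h j)).erase x)).queries
            (oracleAnswer f M)) →
          q ∈ J.biUnion fun j => D j (l.filter (inScale f M h j)) := by
        intro q j hq
        by_cases hj : j ∈ J
        · exact Finset.mem_biUnion.2 ⟨j, hj, hq⟩
        · rw [hout j hj, symmDiff_self] at hq
          simp at hq
      intro q hq
      rw [Finset.mem_symmDiff, mem_queries_solve, mem_queries_solve] at hq
      simp only [hfil] at hq
      rw [Finset.mem_union]
      rcases hq with ⟨⟨y, hy, hq⟩ | ⟨j, hq⟩, hn⟩ | ⟨⟨y, hy, hq⟩ | ⟨j, hq⟩, hn⟩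
      · left
        obtain rfl : y = x := by
          by_contra hyx
          exact hn (.inl ⟨y, hnd.mem_erase_iff.2 ⟨hyx, hy⟩, hq⟩)
        simpa using hq
      · right
        exact hin q j (Finset.mem_symmDiff.2 (.inl ⟨hq, fun h => hn (.inr ⟨j, h⟩)⟩))
      · exact absurd (.inl ⟨y, List.mem_of_mem_erase hy, hq⟩) hn
      · right
        exact hin q j (Finset.mem_symmDiff.2 (.inr ⟨hq, fun h => hn (.inr ⟨j, h⟩)⟩))
    have hcard := (Finset.card_le_card hsub).trans ((Finset.card_union_le _ _).trans
      (add_le_add Finset.card_le_two Finset.card_biUnion_le))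
    simp only [Bool.decide_eq_true]
    exact_mod_cast hcard
  refine (orderAvg_mono hpt).trans ?_
  rw [orderAvg_add, orderAvg_const, orderAvg_sum]
  have hj : ∀ j ∈ J, orderAvg A
      (fun l => ((D j (l.filter fun y => inScale f M h j y = true)).card : ℝ≥0∞)) ≤
      ((2 * N * (k + 2) + N * (4 * N + 2) : ℕ) : ℝ≥0∞) := by
    intro j _
    rw [orderAvg_filter (fun y => inScale f M h j y = true) fun l => ((D j l).card : ℝ≥0∞)]
    by_cases hx : x ∈ A.filter fun y => inScale f M h j y = true
    · exact orderAvg_queries_process_le f M hM _ N x _ hx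
    · refine orderAvg_le fun l hl => ?_
      simp only [hD]
      rw [List.erase_of_not_mem (by rwa [mem_of_mem_orderings hl]), symmDiff_self]
      simp
  calc _ ≤ 2 + ∑ _j ∈ J, ((2 * N * (k + 2) + N * (4 * N + 2) : ℕ) : ℝ≥0∞) := by
        gcongr with j hjJ; exact hj j hjJ
    _ = _ := by
        have : J.card = h + 1 := by rw [hJ, Int.card_Icc]; omega
        rw [Finset.sum_const, this, nsmul_eq_mul, updateBound]
        push_cast; ring

/-! ### Correctness of the static algorithm -/

variable {f M}

omit [DecidableEq V] in
theorem le_optValue {A O : Finset V} (hOA : O ⊆ A) (hO : M.Indep (O : Set V)) :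
    f O ≤ optValue f M A :=
  Finset.le_sup' f (by classical exact Finset.mem_filter.2 ⟨Finset.mem_powerset.2 hOA, hO⟩)

omit [DecidableEq V] in
theorem optValue_le {A : Finset V} {b : ℝ}
    (h : ∀ O ⊆ A, M.Indep (O : Set V) → f O ≤ b) : optValue f M A ≤ b := by
  classical
  refine Finset.sup'_le _ _ fun O hO => ?_
  obtain ⟨h1, h2⟩ := Finset.mem_filter.1 hO
  exact h O (Finset.mem_powerset.1 h1) h2

/-- At the highest scale `j`, elements too small to take part have value at most the threshold `2 ^
(j - h)`, so `Valid.le_of_rejected` covers the whole optimum. The error, `k` times the threshold, is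
small because some single element has value above `2 ^ (j - 1)`. -/
theorem eval_solve_correct (hmono : IsMonotoneSetFun f) (hsub : IsSubmodular f) (hf0 : f ∅ = 0)
    {k h : ℕ} (hM : M.eRank = (k : ℕ∞)) {ε : ℝ} (hε : 0 < ε) (hε1 : ε ≤ 1)
    (hh : 16 * k ≤ ε * 2 ^ h) (l : List V) :
    (solve h (k * (h + 1)) l).eval (oracleAnswer f M) ⊆ l.toFinset ∧
    M.Indep (((solve h (k * (h + 1)) l).eval (oracleAnswer f M) : Finset V) : Set V) ∧
    optValue f M l.toFinset ≤
      (4 + ε) * f ((solve h (k * (h + 1)) l).eval (oracleAnswer f M)) := by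
  rw [solve, QueryTree.eval_bind]
  have hmem := fun z => mem_eval_filterMap_classify f M (l := l) (z := z)
  have hsc := fun j => scaleMembers_eval f M h l j
  generalize (QueryTree.filterMap classify l).eval (oracleAnswer f M) = L at hmem hsc
  have hsingle : ∀ O : Finset V, M.Indep (O : Set V) → ∀ o ∈ O, M.Indep {o} := fun O hO o ho =>
    hO.subset (by simpa using ho)
  cases hL : L.argmax Prod.snd with
  | none =>
    rw [List.argmax_eq_none] at hL
    subst hL
    simp only [QueryTree.eval_pure, Finset.empty_subset, Finset.coe_empty, M.empty_indep,
      true_and, hf0, mul_zero]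
    refine optValue_le fun O hO hOi => ?_
    have h1 := hsub.union_le hmono ∅ O
    rw [Finset.empty_union, hf0, zero_add] at h1
    refine h1.trans (Finset.sum_nonpos fun o ho => ?_)
    rw [sub_zero]
    by_contra! hpos
    have := (hmem (o, Int.clog 2 (f {o}))).2
      ⟨List.mem_toFinset.1 (hO ho), ⟨hpos, hsingle O hOi o ho⟩, rfl⟩
    simp at this
  | some z =>
    obtain ⟨hzl, ⟨hz0, hzi⟩, hz2⟩ := (hmem z).1 (List.argmax_mem hL)
    have hmax : ∀ x ∈ l, 0 < f {x} → M.Indep {x} → Int.clog 2 (f {x}) ≤ z.2 := fun x h1 h2 h3 =>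
      List.le_of_mem_argmax (f := Prod.snd) ((hmem (x, Int.clog 2 (f {x}))).2 ⟨h1, ⟨h2, h3⟩, rfl⟩) hL
    simp only [QueryTree.eval_forEach, QueryTree.eval_bind, QueryTree.eval_pure, hsc]
    obtain ⟨y, j⟩ := z
    simp only at hzl hz0 hzi hz2 hmax ⊢
    have hθ : (0 : ℝ) < 2 ^ (j - h) := by positivity
    have hB : (2 : ℝ) ^ j ≤ 2 ^ h * 2 ^ (j - h) := by
      rw [← zpow_natCast, ← zpow_add₀ (by norm_num)]
      exact le_of_eq (by congr 1; ring)
    have hle : ∀ (x : V) (i : ℤ), Int.clog 2 (f {x}) ≤ i → f {x} ≤ (2 : ℝ) ^ i := fun x i hi =>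
      (Int.self_le_zpow_clog (b := 2) (by norm_num) _).trans (by
        push_cast
        exact zpow_le_zpow_right₀ (by norm_num) hi)
    obtain ⟨hv, -, hsubset, -, hdone⟩ := Valid.eval_process hmono hsub hf0 hθ hM hB (k * (h + 1))
      start (valid_start hf0) (by simp [potential, start]) (l.filter (inScale f M h j))
      (fun x hx => by
        obtain ⟨h1, h2⟩ := (inScale_iff f M).1 (List.mem_filter.1 hx).2
        exact ⟨h1.2, hle x j h2.1⟩)
    rw [← processScale] at hv hsubset hdone
    generalize (processScale h (k * (h + 1)) j (l.filter (inScale f M h j))).eval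
      (oracleAnswer f M) = s at hv hsubset hdone
    refine ⟨?_, hv.indep, ?_⟩
    · refine (hv.sol_subset.trans hsubset).trans fun x hx => ?_
      simp only [start, Finset.empty_union, List.mem_toFinset, List.mem_filter] at hx
      exact List.mem_toFinset.2 hx.1
    have hopt : optValue f M l.toFinset ≤ 4 * f s.sol + k * 2 ^ (j - h) := by
      refine optValue_le fun O hO hOi => hv.le_of_rejected hmono hsub hf0 hθ hM hOi fun o ho => ?_
      have hol := List.mem_toFinset.1 (hO ho)
      have hoi := hsingle O hOi o ho
      by_cases hpos : 0 < f {o}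
      · have hj := hmax o hol hpos hoi
        by_cases hj' : j ≤ Int.clog 2 (f {o}) + h
        · have := hdone o (List.mem_filter.2 ⟨hol, (inScale_iff f M).2 ⟨⟨hpos, hoi⟩, hj, hj'⟩⟩)
          tauto
        -- A scale below `j - h` means a value of at most the threshold.
        · exact .inr (.inr (hle o _ (by omega)))
      · exact .inr (.inr ((not_lt.1 hpos).trans hθ.le))
    have hy : f {y} ≤ optValue f M l.toFinset :=
      le_optValue (by simpa using hzl) (by simpa using hzi)
    have hlow : (2 : ℝ) ^ j < 2 * f {y} := by
      have := Int.zpow_pred_clog_lt_self (b := 2) (by norm_num) hz0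
      rw [← hz2, zpow_sub_one₀ (by norm_num)] at this
      push_cast at this
      linarith
    have hsmall : 8 * (k * (2 : ℝ) ^ (j - h)) ≤ ε * optValue f M l.toFinset := by
      have h2h : (0 : ℝ) < 2 ^ h := by positivity
      rw [zpow_sub₀ (by norm_num), zpow_natCast, ← mul_div_assoc, ← mul_div_assoc,
        div_le_iff₀ h2h]
      have h3 : (k : ℝ) * 2 ^ j ≤ k * (2 * f {y}) := by gcongr
      have h4 : (16 * k) * f {y} ≤ (ε * 2 ^ h) * optValue f M l.toFinset := by gcongr
      linarith
    have hopt0 : 0 < optValue f M l.toFinset := hz0.trans_le hy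
    set Z := optValue f M l.toFinset
    have h5 : Z * (1 - ε / 8) ≤ 4 * f s.sol := by linarith
    -- Here `(1 + ε / 4) * (1 - ε / 8) ≥ 1` since `ε ≤ 1`, and `4 * (1 + ε / 4) = 4 + ε`.
    have h6 : Z ≤ (1 + ε / 4) * (Z * (1 - ε / 8)) := by nlinarith [mul_pos hopt0 hε]
    nlinarith

end SwapState

/-! ### Expectations -/

namespace PMF

variable {α β : Type*}

/-- The expectation of a nonnegative function. -/
noncomputable def expect (p : PMF α) (g : α → ℝ≥0∞) : ℝ≥0∞ := ∑' x, p x * g x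

theorem expect_bind (p : PMF α) (k : α → PMF β) (g : β → ℝ≥0∞) :
    (p.bind k).expect g = p.expect fun x => (k x).expect g := by
  simp only [expect, PMF.bind_apply, ← ENNReal.tsum_mul_right, ← ENNReal.tsum_mul_left, mul_assoc]
  exact ENNReal.tsum_comm

theorem expect_pure (a : α) (g : α → ℝ≥0∞) : (PMF.pure a).expect g = g a := by
  rw [expect, tsum_eq_single a fun b hb => by simp [PMF.pure_apply, hb]]
  simp

theorem expect_map (p : PMF α) (k : α → β) (g : β → ℝ≥0∞) :
    (p.map k).expect g = p.expect fun x => g (k x) := by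
  rw [PMF.map, expect_bind]
  simp only [Function.comp_apply, expect_pure]

theorem expect_mono {p : PMF α} {g h : α → ℝ≥0∞} (H : ∀ x ∈ p.support, g x ≤ h x) :
    p.expect g ≤ p.expect h := by
  refine ENNReal.tsum_le_tsum fun x => ?_
  by_cases hx : x ∈ p.support
  · gcongr; exact H x hx
  · rw [(p.apply_eq_zero_iff x).2 hx, zero_mul, zero_mul]

theorem expect_congr {p : PMF α} {g h : α → ℝ≥0∞} (H : ∀ x ∈ p.support, g x = h x) :
    p.expect g = p.expect h :=
  le_antisymm (expect_mono fun x hx => (H x hx).le) (expect_mono fun x hx => (H x hx).ge)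

theorem expect_add (p : PMF α) (g h : α → ℝ≥0∞) :
    p.expect (fun x => g x + h x) = p.expect g + p.expect h := by
  simp only [expect, mul_add, ENNReal.tsum_add]

theorem expect_const (p : PMF α) (c : ℝ≥0∞) : p.expect (fun _ => c) = c := by
  rw [expect, ENNReal.tsum_mul_right, p.tsum_coe, one_mul]

theorem expect_uniformOfFintype_fin (m : ℕ) (g : Fin (m + 1) → ℝ≥0∞) :
    (PMF.uniformOfFintype (Fin (m + 1))).expect g = ∑ i, g i / ((m + 1 : ℕ) : ℝ≥0∞) := by
  rw [expect, tsum_fintype]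
  refine Finset.sum_congr rfl fun i _ => ?_
  rw [PMF.uniformOfFintype_apply, Fintype.card_fin, mul_comm, div_eq_mul_inv]

end PMF

/-! ### Rerunning a static algorithm on a random order -/

/-- The state of a dynamic algorithm that reruns a static one: a random ordering of the available
elements, the answers that are known, and the current solution. -/
structure RerunState (V : Type u) : Type u where
  order : List V
  table : AnswerTable V
  sol : Finset V

section Rerun

variable {V : Type u} [DecidableEq V] (P : List V → QueryTree V (Finset V))

/-- Run the static algorithm on the ordering `l`, asking only the queries whose answer is not yet
known. -/
noncomputable def rerun (l : List V) (T : AnswerTable V) : OracleComp V (RerunState V) :=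
  (P l).memo (fun S T' => ⟨l, T', S⟩) T

/-- Process an operation: a new element is put at a uniformly random position of the ordering. -/
noncomputable def rerunUpdate (s : RerunState V) : StreamOp V → OracleComp V (RerunState V)
  | .insert x => .uniform s.order.length fun i => rerun P (s.order.insertIdx i x) s.table
  | .delete x => rerun P (s.order.erase x) s.table

/-- The dynamic algorithm that keeps a uniformly random ordering of the available elements, and
reruns the static algorithm `P` after each operation. -/
noncomputable abbrev rerunAlgorithm : DynamicAlgorithm V where
  State := RerunState V
  init := ⟨[], fun _ => none, ∅⟩
  update := rerunUpdate P
  solution s := s.sol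

variable (f : Finset V → ℝ) (M : Matroid V)

/-- The number of queries of the static algorithm that change when `x` is removed. -/
noncomputable def queryDiff (x : V) (l : List V) : ℕ :=
  (symmDiff ((P l).queries (oracleAnswer f M)) ((P (l.erase x)).queries (oracleAnswer f M))).card

/-- The state holds an ordering of `A`, the true answers to the queries of the static algorithm on
this ordering, and its result. -/
structure RerunState.Consistent (A : Finset V) (s : RerunState V) : Prop where
  order_mem : s.order ∈ orderings A
  valid : QueryTree.TableValid f M s.table
  known : ∀ q ∈ (P s.order).queries (oracleAnswer f M), s.table q ≠ none
  sol_eq : s.sol = (P s.order).eval (oracleAnswer f M)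

variable {P f M}

theorem RerunState.Consistent.run_rerun {A A' : Finset V} {s : RerunState V}
    (hs : s.Consistent P f M A) {l : List V} (hl : l ∈ orderings A') :
    ∃ (s' : RerunState V) (m : ℕ), (rerun P l s.table).run f M = PMF.pure (s', m) ∧
      s'.order = l ∧ s'.Consistent P f M A' ∧
      m ≤ ((P l).queries (oracleAnswer f M) \ (P s.order).queries (oracleAnswer f M)).card := by
  obtain ⟨T', m, h1, h2, h3, h4⟩ := QueryTree.run_memo f M
    (fun S T' => (⟨l, T', S⟩ : RerunState V)) (P l) s.table hs.valid
  refine ⟨_, m, h1, rfl, ⟨hl, h2, fun q hq => h3 q (.inr hq), rfl⟩,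
    h4.trans (Finset.card_le_card fun q hq => ?_)⟩
  obtain ⟨hq1, hq2⟩ := Finset.mem_filter.1 hq
  exact Finset.mem_sdiff.2 ⟨hq1, fun h => hs.known q h hq2⟩

variable (P f M) in
/-- A bound on the expected cost of an operation when the current ordering is `l`. -/
noncomputable def stepCost (A : Finset V) : StreamOp V → List V → ℝ≥0∞
  | .insert x, l => ∑ i : Fin (A.card + 1),
      (queryDiff P f M x (l.insertIdx i x) : ℝ≥0∞) / ((A.card + 1 : ℕ) : ℝ≥0∞)
  | .delete x, l => queryDiff P f M x l

/-- The expectation of `g` after an operation when the current ordering is `l`. -/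
noncomputable def stepAvg (A : Finset V) (g : List V → ℝ≥0∞) : StreamOp V → List V → ℝ≥0∞
  | .insert x, l => ∑ i : Fin (A.card + 1), g (l.insertIdx i x) / ((A.card + 1 : ℕ) : ℝ≥0∞)
  | .delete x, l => g (l.erase x)

theorem orderAvg_stepAvg {A : Finset V} {o : StreamOp V} (ho : o.Legal A) (g : List V → ℝ≥0∞) :
    orderAvg A (stepAvg A g o) = orderAvg (o.apply A) g := by
  cases o with
  | insert x => exact orderAvg_insert ho g
  | delete x => exact orderAvg_erase ho g

/-- An insertion is a removal read backwards: the new ordering is uniform on the larger set, and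
erasing `x` gives back the old one. Stability under removal therefore suffices for both operations.
-/
theorem orderAvg_stepCost_le {A : Finset V} {o : StreamOp V} (ho : o.Legal A) {b : ℝ≥0∞}
    (hb : ∀ (A : Finset V) (x : V), orderAvg A (fun l => (queryDiff P f M x l : ℝ≥0∞)) ≤ b) :
    orderAvg A (stepCost P f M A o) ≤ b := by
  cases o with
  | insert x => exact (orderAvg_insert ho fun l => (queryDiff P f M x l : ℝ≥0∞)).trans_le (hb _ x)
  | delete x => exact hb A x

theorem RerunState.Consistent.update {A : Finset V} {s : RerunState V}
    (hs : s.Consistent P f M A) {o : StreamOp V} (ho : o.Legal A) :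
    (∀ y ∈ ((rerunUpdate P s o).run f M).support,
      RerunState.Consistent P f M (o.apply A) y.1) ∧
    (∀ g : List V → ℝ≥0∞, ((rerunUpdate P s o).run f M).expect
      (fun y => g (RerunState.order y.1)) = stepAvg A g o s.order) ∧
    ((rerunUpdate P s o).run f M).expect (fun y => (y.2 : ℝ≥0∞)) ≤
      stepCost P f M A o s.order := by
  have hlen := length_of_mem_orderings hs.order_mem
  cases o with
  | insert x =>
    have hxl : x ∉ s.order := by rwa [mem_of_mem_orderings hs.order_mem]
    have hi : ∀ i : Fin (s.order.length + 1), (i : ℕ) ≤ s.order.length :=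
      fun i => Nat.lt_succ_iff.1 i.2
    choose s' m h1 h2 h3 h4 using fun i : Fin (s.order.length + 1) =>
      hs.run_rerun (perm_insertIdx_mem_orderings ho hs.order_mem (hi i))
    have hrun : (rerunUpdate P s (.insert x)).run f M =
        (PMF.uniformOfFintype (Fin (s.order.length + 1))).bind fun i => PMF.pure (s' i, m i) := by
      change (PMF.uniformOfFintype (Fin (s.order.length + 1))).bind (fun i =>
        (rerun P (s.order.insertIdx i x) s.table).run f M) = _
      simp only [h1]
    have hm : ∀ i, m i ≤ queryDiff P f M x (s.order.insertIdx i x) := by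
      intro i
      refine (h4 i).trans (Finset.card_le_card ?_)
      rw [erase_insertIdx_self hxl (hi i)]
      intro q hq
      exact Finset.mem_symmDiff.2 (.inl (Finset.mem_sdiff.1 hq))
    rw [hrun]
    refine ⟨?_, ?_, ?_⟩
    · intro y hy
      obtain ⟨i, -, hy⟩ := (PMF.mem_support_bind_iff _ _ _).1 hy
      obtain rfl := (PMF.mem_support_pure_iff _ _).1 hy
      exact h3 i
    · intro g
      rw [PMF.expect_bind]
      simp only [PMF.expect_pure, h2]
      rw [PMF.expect_uniformOfFintype_fin, stepAvg, ← hlen]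
    · rw [PMF.expect_bind]
      simp only [PMF.expect_pure]
      rw [PMF.expect_uniformOfFintype_fin, stepCost, ← hlen]
      gcongr with i
      exact hm i
  | delete x =>
    obtain ⟨s', m, h1, h2, h3, h4⟩ := hs.run_rerun (erase_mem_orderings (x := x) hs.order_mem)
    have hrun : (rerunUpdate P s (.delete x)).run f M = PMF.pure (s', m) := h1
    rw [hrun]
    refine ⟨?_, ?_, ?_⟩
    · intro y hy
      obtain rfl := (PMF.mem_support_pure_iff _ _).1 hy
      exact h3
    · intro g
      rw [PMF.expect_pure, h2, stepAvg]
    · rw [PMF.expect_pure, stepCost, queryDiff]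
      refine Nat.cast_le.2 (h4.trans (Finset.card_le_card fun q hq => ?_))
      exact Finset.mem_symmDiff.2 (.inr (Finset.mem_sdiff.1 hq))

/-! ### Evolution of the random ordering and of the cost along a stream -/

/-- Every operation of the list is legal. -/
def LegalOps (ops : List (StreamOp V)) : Prop :=
  ∀ (i : ℕ) (hi : i < ops.length), (ops[i]).Legal (available (ops.take i))

theorem LegalOps.take {ops : List (StreamOp V)} (h : LegalOps ops) (j : ℕ) :
    LegalOps (ops.take j) := by
  intro i hi
  rw [List.length_take] at hi
  have := h i (by omega)
  rwa [List.getElem_take, List.take_take, min_eq_left (by omega)]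

theorem LegalOps.of_append_singleton {ops : List (StreamOp V)} {o : StreamOp V}
    (h : LegalOps (ops ++ [o])) : LegalOps ops ∧ o.Legal (available ops) := by
  constructor
  · have := h.take ops.length
    rwa [List.take_left] at this
  · have := h ops.length (by simp)
    simpa using this

theorem available_append_singleton (ops : List (StreamOp V)) (o : StreamOp V) :
    available (ops ++ [o]) = o.apply (available ops) := by
  simp [available]

omit [DecidableEq V] in
theorem DynamicAlgorithm.run_append_singleton (alg : DynamicAlgorithm V)
    (ops : List (StreamOp V)) (o : StreamOp V) :
    alg.run f M (ops ++ [o]) = (alg.run f M ops).bind fun x =>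
      ((alg.update x.1 o).run f M).map fun y => (y.1, x.2 + y.2) := by
  simp [DynamicAlgorithm.run]

/-- The middle claim, for all `g`, expresses that the stored ordering is uniform. It turns the cost
of the next operation, bounded in terms of the current ordering, into an average over orderings,
which is at most `b`. The hypothesis `hP` makes the initial state consistent at no cost. -/
theorem run_rerunAlgorithm (hP : P [] = .pure ∅) {b : ℝ≥0∞}
    (hb : ∀ (A : Finset V) (x : V), orderAvg A (fun l => (queryDiff P f M x l : ℝ≥0∞)) ≤ b)
    (ops : List (StreamOp V)) (hops : LegalOps ops) :
    (∀ y ∈ ((rerunAlgorithm P).run f M ops).support,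
      RerunState.Consistent P f M (available ops) y.1) ∧
    (∀ g : List V → ℝ≥0∞, ((rerunAlgorithm P).run f M ops).expect
      (fun y => g (RerunState.order y.1)) = orderAvg (available ops) g) ∧
    ((rerunAlgorithm P).run f M ops).expect (fun y => (y.2 : ℝ≥0∞)) ≤ ops.length * b := by
  induction ops using List.reverseRecOn with
  | nil =>
    have hrun : (rerunAlgorithm P).run f M [] = PMF.pure ((rerunAlgorithm P).init, 0) := rfl
    rw [hrun]
    refine ⟨?_, ?_, ?_⟩
    · intro y hy
      obtain rfl := (PMF.mem_support_pure_iff _ _).1 hy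
      refine ⟨by simp [available, orderings_empty], ?_, ?_, ?_⟩
      · intro q r h; simp at h
      · intro q hq; simp [hP] at hq
      · simp [hP]
    · intro g
      rw [PMF.expect_pure, available, List.foldl_nil, orderAvg_empty]
    · simp [PMF.expect_pure]
  | append_singleton ops o ih =>
    obtain ⟨hops, ho⟩ := hops.of_append_singleton
    obtain ⟨ih1, ih2, ih3⟩ := ih hops
    rw [DynamicAlgorithm.run_append_singleton, available_append_singleton]
    refine ⟨?_, ?_, ?_⟩
    · intro y hy
      obtain ⟨x, hx, hy⟩ := (PMF.mem_support_bind_iff _ _ _).1 hy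
      obtain ⟨z, hz, rfl⟩ := (PMF.mem_support_map_iff _ _ _).1 hy
      exact ((ih1 x hx).update ho).1 z hz
    · intro g
      rw [PMF.expect_bind]
      simp only [PMF.expect_map]
      rw [PMF.expect_congr fun x hx => ((ih1 x hx).update ho).2.1 g, ih2, orderAvg_stepAvg ho]
    · rw [PMF.expect_bind]
      simp only [PMF.expect_map, Nat.cast_add, PMF.expect_add, PMF.expect_const]
      rw [List.length_append, List.length_singleton, Nat.cast_add, add_mul, Nat.cast_one, one_mul]
      refine add_le_add ih3 ?_
      refine (PMF.expect_mono fun x hx => ((ih1 x hx).update ho).2.2).trans ?_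
      rw [ih2]
      exact orderAvg_stepCost_le ho hb

theorem rerunAlgorithm_isApproximation (hP : P [] = .pure ∅) {b : ℝ≥0∞}
    (hb : ∀ (A : Finset V) (x : V), orderAvg A (fun l => (queryDiff P f M x l : ℝ≥0∞)) ≤ b)
    {a : ℝ} (ha : ∀ l : List V, (P l).eval (oracleAnswer f M) ⊆ l.toFinset ∧
      M.Indep (((P l).eval (oracleAnswer f M) : Finset V) : Set V) ∧
      optValue f M l.toFinset ≤ a * f ((P l).eval (oracleAnswer f M))) :
    (rerunAlgorithm P).IsApproximation f M a := by
  intro n ops hops i _ x hx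
  have hcons := (run_rerunAlgorithm hP hb _ (LegalOps.take hops.legal i)).1 x hx
  have hA := (mem_orderings.1 hcons.order_mem).2
  have hsol : (rerunAlgorithm P).solution x.1 = (P (RerunState.order x.1)).eval (oracleAnswer f M) :=
    hcons.sol_eq
  rw [hsol, ← hA]
  exact ha _

theorem rerunAlgorithm_hasAmortizedTime (hP : P [] = .pure ∅) {b : ℝ≥0∞}
    (hb : ∀ (A : Finset V) (x : V), orderAvg A (fun l => (queryDiff P f M x l : ℝ≥0∞)) ≤ b)
    {t : ℕ → ℝ} (ht : ∀ n, 1 ≤ n → b ≤ ENNReal.ofReal (t n)) :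
    (rerunAlgorithm P).HasAmortizedTime f M t := by
  intro n ops hops
  have hlen : ops.length = 2 * n := by
    have h1 := List.length_eq_countP_add_countP (fun o : StreamOp V => o.isInsert) (l := ops)
    have h2 := hops.insertions
    have h3 := hops.deletions
    simp only [Bool.not_eq_true, Bool.decide_eq_false] at h1
    omega
  refine ((run_rerunAlgorithm hP hb ops hops.legal).2.2).trans ?_
  rw [hlen]
  -- For `n = 0` the stream is empty and costs nothing, so nothing is asked of `t 0`, which vanishes
  -- in the application.
  rcases Nat.eq_zero_or_pos n with rfl | hn
  · simp
  · rw [ENNReal.ofReal_mul (by positivity)]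
    refine mul_le_mul' (le_of_eq ?_) (ht n hn)
    rw [← ENNReal.ofReal_natCast]
    push_cast; rfl

end Rerun

/-! ### The main theorem -/

theorem updateBound_le {k h : ℕ} (hk : 1 ≤ k) :
    SwapState.updateBound k h (k * (h + 1)) ≤ 14 * (k ^ 2 * (h + 2) ^ 3) := by
  have hN : k * (h + 1) ≤ k * (h + 2) := Nat.mul_le_mul_left _ (by omega)
  have hH : 1 ≤ h + 2 := by omega
  set H := h + 2
  calc SwapState.updateBound k h (k * (h + 1))
      ≤ 2 + H * (2 * (k * H) * (3 * k) + (k * H) * (4 * (k * H) + 2)) := by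
        rw [SwapState.updateBound]
        gcongr <;> omega
    _ = 2 * (1 * 1) + 6 * (k ^ 2 * (H ^ 2 * 1)) + 4 * (k ^ 2 * H ^ 3) +
          2 * (k * 1 * (H ^ 2 * 1)) := by ring
    _ ≤ 2 * (k ^ 2 * H ^ 3) + 6 * (k ^ 2 * (H ^ 2 * H)) + 4 * (k ^ 2 * H ^ 3) +
          2 * (k * k * (H ^ 2 * H)) := by
        gcongr
        · exact Nat.one_le_pow _ _ hk
        · exact Nat.one_le_pow _ _ hH
    _ = 14 * (k ^ 2 * H ^ 3) := by ring

/-- The number of scales below the highest one that are used for a given rank and precision. -/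
noncomputable def scaleDepth (k : ℕ) (ε : ℝ) : ℕ := ⌈Real.logb 2 (16 * k / ε)⌉₊

theorem le_mul_two_pow_scaleDepth {k : ℕ} (hk : 1 ≤ k) {ε : ℝ} (hε : 0 < ε) :
    16 * (k : ℝ) ≤ ε * 2 ^ scaleDepth k ε := by
  have hk' : (0 : ℝ) < k := by exact_mod_cast hk
  have h1 : Real.logb 2 (16 * k / ε) ≤ (scaleDepth k ε : ℝ) := Nat.le_ceil _
  rw [Real.logb_le_iff_le_rpow (by norm_num) (by positivity), Real.rpow_natCast,
    div_le_iff₀ hε] at h1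
  linarith

/-- The additive constants, 2 plus 1 for rounding up plus the logarithm of `16 * max E 1`, are
absorbed into a multiple of `Real.log (k / ε + 1)`, which is at least `Real.log (1 / E + 1) > 0`.
This makes the constant depend on `E`. -/
theorem scaleDepth_add_two_le {k : ℕ} (hk : 1 ≤ k) {ε E : ℝ} (hε : 0 < ε) (hεE : ε ≤ E) :
    (scaleDepth k (min ε 1) : ℝ) + 2 ≤
      ((3 + Real.logb 2 (16 * max E 1)) / Real.log (1 / E + 1) + 1 / Real.log 2) *
        Real.log (k / ε + 1) := by
  have hE : 0 < E := hε.trans_le hεE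
  have hk' : (1 : ℝ) ≤ k := by exact_mod_cast hk
  have hD : 1 ≤ max E 1 := le_max_right _ _
  have hm : 0 < min ε 1 := lt_min hε one_pos
  have hy : 0 < (k : ℝ) / ε := by positivity
  have hle : 16 * (k : ℝ) / min ε 1 ≤ 16 * max E 1 * (k / ε + 1) := by
    have h1 : ε ≤ max E 1 * min ε 1 := by
      rcases le_total ε 1 with h | h
      · rw [min_eq_left h]; nlinarith
      · rw [min_eq_right h, mul_one]; exact hεE.trans (le_max_left _ _)
    have h2 : (k : ℝ) / min ε 1 ≤ max E 1 * (k / ε) := by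
      rw [div_le_iff₀ hm, ← mul_div_assoc, div_mul_eq_mul_div, le_div_iff₀ hε]
      nlinarith
    rw [mul_div_assoc]
    nlinarith
  have h0 : 0 ≤ Real.logb 2 (16 * k / min ε 1) := by
    refine Real.logb_nonneg (by norm_num) ?_
    rw [le_div_iff₀ hm]
    linarith [min_le_right ε 1]
  have h1 : (scaleDepth k (min ε 1) : ℝ) ≤ Real.logb 2 (16 * k / min ε 1) + 1 :=
    (Nat.ceil_lt_add_one h0).le
  have h2 : Real.logb 2 (16 * k / min ε 1) ≤
      Real.logb 2 (16 * max E 1) + Real.log (k / ε + 1) / Real.log 2 := by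
    refine (Real.logb_le_logb_of_le (by norm_num) (by positivity) hle).trans (le_of_eq ?_)
    rw [Real.logb_mul (by positivity) (by positivity)]
    rfl
  have hl0 : 0 < Real.log (1 / E + 1) := Real.log_pos (by
    have : 0 < 1 / E := by positivity
    linarith)
  have hl : Real.log (1 / E + 1) ≤ Real.log (k / ε + 1) := by
    refine Real.log_le_log (by positivity) ?_
    gcongr
  have hc : 0 ≤ 3 + Real.logb 2 (16 * max E 1) := by
    have : 0 ≤ Real.logb 2 (16 * max E 1) := Real.logb_nonneg (by norm_num) (by linarith)
    linarith
  have h3 : 3 + Real.logb 2 (16 * max E 1) ≤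
      (3 + Real.logb 2 (16 * max E 1)) / Real.log (1 / E + 1) * Real.log (k / ε + 1) := by
    rw [div_mul_eq_mul_div, le_div_iff₀ hl0]
    exact mul_le_mul_of_nonneg_left hl hc
  rw [add_mul, one_div_mul_eq_div]
  linarith

theorem updateBound_le_of_eps_le {k n : ℕ} (hk : 1 ≤ k) (hn : 1 ≤ n) {ε E K : ℝ} (hε : 0 < ε)
    (hεE : ε ≤ E) {h : ℕ} (hh : (h : ℝ) + 2 ≤ K * Real.log (k / ε + 1)) :
    (SwapState.updateBound k h (k * (h + 1)) : ℝ) ≤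
      14 * K ^ 3 * E / Real.log 2 ^ 3 *
        ((k : ℝ) ^ 2 / ε * Real.log (k + 1) * Real.log (n + 1) ^ 2 *
          Real.log (k / ε + 1) ^ 3) := by
  have hl2 : 0 < Real.log 2 := Real.log_pos (by norm_num)
  have hlog : ∀ m : ℕ, 1 ≤ m → Real.log 2 ≤ Real.log (m + 1) := fun m hm => by
    refine Real.log_le_log (by norm_num) ?_
    have : (1 : ℝ) ≤ m := by exact_mod_cast hm
    linarith
  have h1 : (SwapState.updateBound k h (k * (h + 1)) : ℝ) ≤ 14 * (k ^ 2 * ((h : ℝ) + 2) ^ 3) := by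
    exact_mod_cast updateBound_le hk
  have h2 : ((h : ℝ) + 2) ^ 3 ≤ (K * Real.log (k / ε + 1)) ^ 3 :=
    pow_le_pow_left₀ (by positivity) hh 3
  -- These factors of the claimed bound are not needed; each is at least 1 after normalization and
  -- is inserted for free.
  have h3 : 1 ≤ E / ε * (Real.log (k + 1) / Real.log 2) * (Real.log (n + 1) / Real.log 2) ^ 2 := by
    have a1 : 1 ≤ E / ε := (one_le_div hε).2 hεE
    have a2 : 1 ≤ Real.log (k + 1) / Real.log 2 := (one_le_div hl2).2 (hlog k hk)
    have a3 : 1 ≤ Real.log (n + 1) / Real.log 2 := (one_le_div hl2).2 (hlog n hn)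
    exact one_le_mul_of_one_le_of_one_le (one_le_mul_of_one_le_of_one_le a1 a2) (one_le_pow₀ a3)
  have h4 : (0 : ℝ) ≤ 14 * (k ^ 2 * (K * Real.log (k / ε + 1)) ^ 3) := by
    have : (0 : ℝ) ≤ (K * Real.log (k / ε + 1)) ^ 3 := le_trans (by positivity) h2
    positivity
  calc (SwapState.updateBound k h (k * (h + 1)) : ℝ)
      ≤ 14 * (k ^ 2 * (K * Real.log (k / ε + 1)) ^ 3) := h1.trans (by gcongr)
    _ ≤ 14 * (k ^ 2 * (K * Real.log (k / ε + 1)) ^ 3) *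
        (E / ε * (Real.log (k + 1) / Real.log 2) * (Real.log (n + 1) / Real.log 2) ^ 2) :=
        le_mul_of_one_le_right h4 h3
    _ = _ := by field_simp

theorem mainTheorem2 :
    ∃ c : ℝ, 0 < c ∧ ∀ E : ℝ, 0 < E → ∃ C : ℝ, 0 < C ∧
      ∀ (V : Type u) [DecidableEq V] (ε : ℝ) (k : ℕ), 0 < ε → ε ≤ E →
        ∃ alg : DynamicAlgorithm V,
          ∀ (f : Finset V → ℝ) (M : Matroid V),
            IsMonotoneSetFun f → IsSubmodular f → f ∅ = 0 → M.eRank = (k : ℕ∞) →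
              alg.IsApproximation f M (4 + c * ε) ∧
              alg.HasAmortizedTime f M (fun n =>
                C * ((k : ℝ) ^ 2 / ε * Real.log (k + 1) * Real.log (n + 1) ^ 2 *
                  Real.log (k / ε + 1) ^ 3)) := by
  refine ⟨1, one_pos, fun E hE => ?_⟩
  set K := (3 + Real.logb 2 (16 * max E 1)) / Real.log (1 / E + 1) + 1 / Real.log 2 with hK
  have hl2 : 0 < Real.log 2 := Real.log_pos (by norm_num)
  have hK0 : 0 < K := by
    have h1 : 0 ≤ Real.logb 2 (16 * max E 1) :=
      Real.logb_nonneg (by norm_num) (by linarith [le_max_right E 1])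
    have h2 : 0 < Real.log (1 / E + 1) := Real.log_pos (by
      have : 0 < 1 / E := by positivity
      linarith)
    positivity
  refine ⟨14 * K ^ 3 * E / Real.log 2 ^ 3, by positivity, fun V _ ε k hε hεE => ?_⟩
  -- In rank 0 the time bound is 0, so no oracle call is allowed; the empty solution is optimal.
  rcases Nat.eq_zero_or_pos k with rfl | hk
  · refine ⟨rerunAlgorithm fun _ => .pure ∅, fun f M _ _ hf0 hM => ?_⟩
    have hb : ∀ (A : Finset V) (x : V), orderAvg A
        (fun l => (queryDiff (fun _ => .pure ∅) f M x l : ℝ≥0∞)) ≤ 0 :=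
      fun A x => orderAvg_le fun l _ => by simp [queryDiff]
    refine ⟨rerunAlgorithm_isApproximation rfl hb fun l => ⟨by simp, by simp, ?_⟩,
      rerunAlgorithm_hasAmortizedTime rfl hb fun n _ => by simp⟩
    refine SwapState.optValue_le fun O _ hO => ?_
    obtain rfl : O = ∅ := Finset.card_eq_zero.1 (Nat.le_zero.1 (SwapState.card_sol_le M hM hO))
    simp [hf0]
  -- Correctness of the static algorithm requires precision at most 1; a ratio of `4 + min ε 1` is
  -- good enough.
  · set h := scaleDepth k (min ε 1) with hh
    refine ⟨rerunAlgorithm (SwapState.solve h (k * (h + 1))), fun f M hmono hsub hf0 hM => ?_⟩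
    have hb : ∀ (A : Finset V) (x : V), orderAvg A
        (fun l => (queryDiff (SwapState.solve h (k * (h + 1))) f M x l : ℝ≥0∞)) ≤
          (SwapState.updateBound k h (k * (h + 1)) : ℝ≥0∞) :=
      fun A x => SwapState.orderAvg_queries_solve_le f M hM h _ x A
    refine ⟨rerunAlgorithm_isApproximation rfl hb fun l => ?_,
      rerunAlgorithm_hasAmortizedTime rfl hb fun n hn => ?_⟩
    · obtain ⟨h1, h2, h3⟩ := SwapState.eval_solve_correct hmono hsub hf0 hM (lt_min hε one_pos)
        (min_le_right ε 1) (le_mul_two_pow_scaleDepth hk (lt_min hε one_pos)) l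
      refine ⟨h1, h2, h3.trans (mul_le_mul_of_nonneg_right ?_ ?_)⟩
      · linarith [min_le_left ε 1]
      · rw [← hf0]
        exact hmono.monotone (Finset.empty_subset _)
    · rw [← ENNReal.ofReal_natCast]
      exact ENNReal.ofReal_le_ofReal
        (updateBound_le_of_eps_le hk hn hε hεE (scaleDepth_add_two_le hk hε hεE))
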